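/- Write $\boldsymbol{T} = (\boldsymbol{R}\cup\{-\infty\}, \max, +)$. A tropical curve $\Gamma$ is the space obtained from a finite connected nonempty multigraph $G$ (loops allowed) with edge lengths $l(e) \in (0,\infty]$, where only leaf edges may have infinite length, by identifying each edge $e$ with $[0,l(e)]$ so that the end $\infty$ of an edge of infinite length is a leaf end; such ends are the points at infinity, they form the set $\Gamma_\infty$, and all other points are finite. $\Gamma$ carries the path distance $\operatorname{dist}$, a point at infinity being infinitely far from every other point. $\operatorname{Rat}(\Gamma)$ is the set of continuous functions $f : \Gamma \to \boldsymbol{R}\cup\{\pm\infty\}$ that are either constantly $-\infty$ or piecewise affine with integer slopes and finitely many pieces, taking the values $\pm\infty$ only at points at infinity. It is a semifield under $f \oplus g = \max\{f,g\}$ and $f \odot g = f+g$ (extended by continuity to the points at infinity), and it contains the constants $\boldsymbol{T}$. For $A \subset \Gamma$ and $l \in (0,\infty]$ put $\operatorname{CF}(A;l)(x) := -\min(l, \operatorname{dist}(x,A))$. For $r \in \boldsymbol{R}_{>0}$, an $r$-expansive map $\Gamma_1 \to \Gamma_2$ is a continuous bijection that restricts to a bijection $\varphi: \Gamma_1\setminus\Gamma_{1\infty}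 \to \Gamma_2\setminus\Gamma_{2\infty}$ with $\operatorname{dist}(\varphi(x),\varphi(y)) = r\cdot\operatorname{dist}(x,y)$. Let $\Gamma_1,\Gamma_2$ be tropical curves and let $\psi : \operatorname{Rat}(\Gamma_1) \to \operatorname{Rat}(\Gamma_2)$ be a semiring isomorphism. Then the image $r := \psi(1)$ of the constant function with real value $1$ is a constant function with value in $\boldsymbol{R}_{>0}$. Moreover, $\psi$ induces a map $\varphi : \Gamma_1 \to \Gamma_2$; that is, there is a unique map $\varphi$ with the following two properties: (1) every finite point $x$ is mapped to a finite point, and $\psi(\operatorname{CF}(\{x\};\varepsilon)) = \operatorname{CF}(\{\varphi(x)\}; r\varepsilon)$ for some $\varepsilon > 0$; (2) every point at infinity $x$ is mapped to a point at infinity, and there is a finite point $y$ on the edge incident to $x$ such that $\varphi(y)$ is a finite point on the edge incident to $\varphi(x)$ and $\psi(\operatorname{CF}(\Gamma_1\setminus(y,x];\infty)) = \operatorname{CF}(\Gamma_2\setminus(\varphi(y),\varphi(x)];\infty)$. This $\varphi$ is an $r$-expansive map, and $$\psi(f) = (r\cdot f)\circ\varphi^{-1} \qquad \text{for every } f \in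 \operatorname{Rat}(\Gamma_1),$$ where $r\cdot(\pm\infty) = \pm\infty$. -/

import Mathlib

open Set Filter Topology
open scoped ENNReal

universe u v

/-- A finite connected nonempty multigraph (loops and multiple edges allowed) with edge lengths in
`(0, ∞]`.  Each edge `e` is oriented from `src e` to `tgt e`; the orientation only fixes the
identification of `e` with `[0, len e]`.  An edge of infinite length is a leaf edge, and its end
`tgt e`, which is identified with `∞`, is a leaf end. -/
structure EdgeWeightedGraph where
  /-- vertices -/
  V : Type u
  /-- edges -/
  E : Type u
  finite_V : Finite V
  finite_E : Finite E
  nonempty_V : Nonempty V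
  src : E → V
  tgt : E → V
  len : E → ℝ≥0∞
  len_pos : ∀ e, 0 < len e
  connected : ∀ v w : V, Relation.EqvGen (fun a b => ∃ e, src e = a ∧ tgt e = b) v w
  /-- The valence of `tgt e` (loops are counted twice) is one when `e` has infinite length. -/
  leaf_of_len_eq_top : ∀ e, len e = ⊤ →
    Nat.card {e' : E // src e' = tgt e} + Nat.card {e' : E // tgt e' = tgt e} = 1

namespace EdgeWeightedGraph

variable (Γ : EdgeWeightedGraph.{u})

instance : TopologicalSpace Γ.V := ⊥

instance : DiscreteTopology Γ.V := ⟨rfl⟩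

/-- The disjoint union of the vertices and of the closed intervals `[0, len e]`. -/
abbrev PrePt : Type u := Γ.V ⊕ (Σ e : Γ.E, Icc (0 : ℝ≥0∞) (Γ.len e))

/-- The start of the interval `[0, len e]`. -/
def origin (e : Γ.E) : Icc (0 : ℝ≥0∞) (Γ.len e) := ⟨0, le_rfl, zero_le⟩

/-- The end of the interval `[0, len e]`. -/
def terminus (e : Γ.E) : Icc (0 : ℝ≥0∞) (Γ.len e) := ⟨Γ.len e, zero_le, le_rfl⟩

/-- The ends of the intervals are glued to the vertices. -/
inductive Glue : Γ.PrePt → Γ.PrePt → Prop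
  | src (e : Γ.E) : Glue (Sum.inr ⟨e, Γ.origin e⟩) (Sum.inl (Γ.src e))
  | tgt (e : Γ.E) : Glue (Sum.inr ⟨e, Γ.terminus e⟩) (Sum.inl (Γ.tgt e))

/-- The tropical curve obtained from an edge-weighted graph, with the quotient topology. -/
def Pt : Type u := Quot Γ.Glue

instance : TopologicalSpace Γ.Pt := inferInstanceAs (TopologicalSpace (Quot Γ.Glue))

/-- The point of the tropical curve at the coordinate `t` of the edge `e`. -/
def pt (e : Γ.E) (t : Icc (0 : ℝ≥0∞) (Γ.len e)) : Γ.Pt := Quot.mk _ (Sum.inr ⟨e, t⟩)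

variable {Γ}

/-- Points at infinity: the ends `∞` of the edges `[0, ∞]`. -/
def IsInfinite (x : Γ.Pt) : Prop := ∃ e, Γ.len e = ⊤ ∧ x = Γ.pt e (Γ.terminus e)

/-- `ChainLength x y L`: the point `y` can be reached from `x` by finitely many moves inside edges,
of total length `L`. -/
inductive ChainLength : Γ.Pt → Γ.Pt → ℝ≥0∞ → Prop
  | refl (x : Γ.Pt) : ChainLength x x 0
  | step (e : Γ.E) (s t : Icc (0 : ℝ≥0∞) (Γ.len e)) (y : Γ.Pt) (L : ℝ≥0∞) :
      ChainLength (Γ.pt e t) y L →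
      ChainLength (Γ.pt e s) y ((((s : ℝ≥0∞) - t) + ((t : ℝ≥0∞) - s)) + L)

/-- The distance of a tropical curve: the infimum of the lengths of the paths.  A point at infinity
has infinite distance to any other point. -/
noncomputable def pdist (x y : Γ.Pt) : ℝ≥0∞ := sInf {L | ChainLength x y L}

/-- On each edge, `f` is affine with an integer slope on every interval that avoids a
suitable finite set of break points. -/
def IsPiecewiseAffine (f : Γ.Pt → EReal) : Prop :=
  ∀ e, ∃ S : Finset ℝ≥0∞, ∀ a b : ℝ≥0∞, (∀ s ∈ S, s ∉ Ioo a b) →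
    ∃ (m : ℤ) (c : ℝ), ∀ t : Icc (0 : ℝ≥0∞) (Γ.len e), a < t → (t : ℝ≥0∞) < b →
      f (Γ.pt e t) = ((m * (t : ℝ≥0∞).toReal + c : ℝ) : EReal)

/-- Rational functions: continuous, and either constantly `-∞` or piecewise affine with integer
slopes and finitely many pieces, with values `±∞` only at points at infinity. -/
def IsRational (f : Γ.Pt → EReal) : Prop :=
  Continuous f ∧ ((∀ x, f x = ⊥) ∨
    ((∀ x, ¬ IsInfinite x → f x ≠ ⊥ ∧ f x ≠ ⊤) ∧ IsPiecewiseAffine f))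

/-! Basic facts on points at infinity. -/

lemma src_ne_tgt_of_top {e : Γ.E} (h : Γ.len e = ⊤) (e' : Γ.E) : Γ.src e' ≠ Γ.tgt e := by
  intro h1
  have := Γ.finite_E
  have h2 := Γ.leaf_of_len_eq_top e h
  have h3 : 0 < Nat.card {e' : Γ.E // Γ.src e' = Γ.tgt e} :=
    Nat.card_pos_iff.2 ⟨⟨⟨e', h1⟩⟩, inferInstance⟩
  have h4 : 0 < Nat.card {e' : Γ.E // Γ.tgt e' = Γ.tgt e} :=
    Nat.card_pos_iff.2 ⟨⟨⟨e, rfl⟩⟩, inferInstance⟩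
  omega

lemma eq_of_tgt_eq_of_top {e : Γ.E} (h : Γ.len e = ⊤) {e' : Γ.E} (h1 : Γ.tgt e' = Γ.tgt e) :
    e' = e := by
  have := Γ.finite_E
  have h2 := Γ.leaf_of_len_eq_top e h
  have h3 : Nat.card {e' : Γ.E // Γ.tgt e' = Γ.tgt e} ≤ 1 := by omega
  have h4 := Finite.card_le_one_iff_subsingleton.1 h3
  exact congrArg Subtype.val
    (h4.elim (⟨e', h1⟩ : {e' : Γ.E // Γ.tgt e' = Γ.tgt e}) ⟨e, rfl⟩)

/-- The neighbourhood `(a, ∞]` of the end of an edge of infinite length. -/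
def endNhd {e : Γ.E} (h : Γ.len e = ⊤) {a : ℝ≥0∞} (ha : a < ⊤) : Set Γ.Pt :=
  fun x => Quot.lift (r := Γ.Glue) (fun p : Γ.PrePt => match p with
    | Sum.inl v => v = Γ.tgt e
    | Sum.inr q => q.1 = e ∧ a < (q.2 : ℝ≥0∞)) (by
      rintro _ _ (e' | e')
      · simp only [origin, not_lt_zero, and_false, src_ne_tgt_of_top h e']
      · simp only [terminus, eq_iff_iff]
        constructor
        · rintro ⟨rfl, -⟩
          rfl
        · intro h1
          obtain rfl := eq_of_tgt_eq_of_top h h1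
          exact ⟨rfl, h ▸ ha⟩) x

lemma pt_mem_endNhd {e : Γ.E} (h : Γ.len e = ⊤) {a : ℝ≥0∞} (ha : a < ⊤) (e' : Γ.E)
    (t : Icc (0 : ℝ≥0∞) (Γ.len e')) : Γ.pt e' t ∈ endNhd h ha ↔ e' = e ∧ a < (t : ℝ≥0∞) :=
  Iff.rfl

lemma exists_of_mem_endNhd {e : Γ.E} (h : Γ.len e = ⊤) {a : ℝ≥0∞} (ha : a < ⊤) {x : Γ.Pt}
    (hx : x ∈ endNhd h ha) : ∃ t : Icc (0 : ℝ≥0∞) (Γ.len e), a < (t : ℝ≥0∞) ∧ x = Γ.pt e t := by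
  induction x using Quot.ind with
  | mk p =>
    rcases p with w | ⟨e', t⟩
    · have hv : w = Γ.tgt e := hx
      subst hv
      exact ⟨Γ.terminus e, by simpa [terminus, h] using ha, (Quot.sound (Glue.tgt e)).symm⟩
    · obtain ⟨rfl, h2⟩ : e' = e ∧ a < (t : ℝ≥0∞) := hx
      exact ⟨t, h2, rfl⟩

lemma isOpen_endNhd {e : Γ.E} (h : Γ.len e = ⊤) {a : ℝ≥0∞} (ha : a < ⊤) :
    IsOpen (endNhd h ha) := by
  have hq : IsQuotientMap (Quot.mk Γ.Glue) := isQuotientMap_quot_mk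
  refine hq.isOpen_preimage.1 ?_
  rw [isOpen_sum_iff]
  refine ⟨isOpen_discrete _, ?_⟩
  rw [isOpen_sigma_iff]
  intro e'
  by_cases he : e' = e
  · have : {t : Icc (0 : ℝ≥0∞) (Γ.len e') | a < (t : ℝ≥0∞)} =
        Sigma.mk e' ⁻¹' (Sum.inr ⁻¹' (Quot.mk Γ.Glue ⁻¹' endNhd h ha)) := by
      ext t
      exact ⟨fun h1 => ⟨he, h1⟩, fun h1 => h1.2⟩
    rw [← this]
    exact isOpen_lt continuous_const continuous_subtype_val
  · convert isOpen_empty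
    ext t
    exact ⟨fun h1 => (he h1.1).elim, fun h1 => h1.elim⟩

lemma continuous_pt (e : Γ.E) : Continuous (Γ.pt e) :=
  continuous_quot_mk.comp (continuous_inr.comp continuous_sigmaMk)

lemma not_isInfinite_pt {e : Γ.E} {t : Icc (0 : ℝ≥0∞) (Γ.len e)} (ht : (t : ℝ≥0∞) < ⊤) :
    ¬ IsInfinite (Γ.pt e t) := by
  rintro ⟨e', h, h1⟩
  have h2 : Γ.pt e' (Γ.terminus e') ∈ endNhd h ht := ⟨rfl, by simpa [terminus, h] using ht⟩
  rw [← h1] at h2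
  exact lt_irrefl _ h2.2

lemma dense_finite : Dense {x : Γ.Pt | ¬ IsInfinite x} := by
  intro x
  by_cases hx : IsInfinite x
  · obtain ⟨e, h, rfl⟩ := hx
    have h1 : Γ.terminus e ∈ closure {t : Icc (0 : ℝ≥0∞) (Γ.len e) | (t : ℝ≥0∞) < ⊤} := by
      let w : ℕ → Icc (0 : ℝ≥0∞) (Γ.len e) := fun n => ⟨n, zero_le, by simp [h]⟩
      refine mem_closure_of_tendsto (f := w) (b := atTop) ?_ (Eventually.of_forall fun n => ?_)
      · rw [tendsto_subtype_rng]
        simpa [w, terminus, h] using ENNReal.tendsto_nat_nhds_top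
      · simp [w]
    refine closure_mono ?_ (image_closure_subset_closure_image (continuous_pt e)
      ⟨_, h1, rfl⟩)
    rintro _ ⟨t, ht, rfl⟩
    exact not_isInfinite_pt ht
  · exact subset_closure hx

/-- A sum of two rational functions, restricted to finite points, has a limit at every point. -/
lemma exists_tendsto_add {f g : Γ.Pt → EReal} (hf : IsRational f) (hg : IsRational g) (x : Γ.Pt) :
    ∃ l, Tendsto (fun y => f y + g y) (𝓝[{y : Γ.Pt | ¬ IsInfinite y}] x) (𝓝 l) ∧
      (¬ IsInfinite x → l = f x + g x) := by
  obtain ⟨hfc, hf⟩ := hf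
  obtain ⟨hgc, hg⟩ := hg
  rcases hf with hf | ⟨hf, hfp⟩
  · exact ⟨⊥, by simp [hf, tendsto_const_nhds], by simp [hf]⟩
  rcases hg with hg | ⟨hg, hgp⟩
  · exact ⟨⊥, by simp [hg, tendsto_const_nhds], by simp [hg]⟩
  by_cases hx : IsInfinite x
  swap
  · refine ⟨f x + g x, tendsto_nhdsWithin_of_tendsto_nhds ?_, fun _ => rfl⟩
    have h1 : ContinuousAt (fun p : EReal × EReal => p.1 + p.2) (f x, g x) :=
      EReal.continuousAt_add (Or.inl (hf x hx).2) (Or.inl (hf x hx).1)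
    exact h1.tendsto.comp ((hfc.tendsto x).prodMk_nhds (hgc.tendsto x))
  obtain ⟨e, h, rfl⟩ := hx
  have key : ∀ k : Γ.Pt → EReal, IsPiecewiseAffine k → ∃ (a : ℝ≥0∞) (m : ℤ) (c : ℝ), a < ⊤ ∧
      ∀ t : Icc (0 : ℝ≥0∞) (Γ.len e), a < t → (t : ℝ≥0∞) < ⊤ →
      k (Γ.pt e t) = ((m * (t : ℝ≥0∞).toReal + c : ℝ) : EReal) := by
    intro k hk
    obtain ⟨S, hS⟩ := hk e
    have ha : (S.filter (· < ⊤)).sup id < ⊤ := by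
      rw [Finset.sup_lt_iff (by simp)]
      simp
    obtain ⟨m, c, hmc⟩ := hS ((S.filter (· < ⊤)).sup id) ⊤ (by
      rintro s hs ⟨h1, h2⟩
      have h3 : s ≤ (S.filter (· < ⊤)).sup id :=
        Finset.le_sup (f := id) (Finset.mem_filter.2 ⟨hs, h2⟩)
      exact absurd h1 h3.not_gt)
    exact ⟨_, m, c, ha, hmc⟩
  obtain ⟨a, m, c, ha, h1⟩ := key f hfp
  obtain ⟨a', m', c', ha', h2⟩ := key g hgp
  have hlim : ∃ l : EReal, Tendsto
      (fun s : ℝ => ((((m + m' : ℤ) : ℝ) * s + (c + c') : ℝ) : EReal)) atTop (𝓝 l) := by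
    rcases lt_trichotomy (m + m') 0 with hm | hm | hm
    · exact ⟨⊥, EReal.tendsto_coe_nhds_bot_iff.2 (tendsto_atBot_add_const_right _ _
        (tendsto_id.const_mul_atTop_of_neg (by exact_mod_cast hm)))⟩
    · exact ⟨((c + c' : ℝ) : EReal), by simp only [hm]; simp⟩
    · exact ⟨⊤, EReal.tendsto_coe_nhds_top_iff.2 (tendsto_atTop_add_const_right _ _
        (tendsto_id.const_mul_atTop (by exact_mod_cast hm)))⟩
  obtain ⟨l, hl⟩ := hlim
  refine ⟨l, ?_, fun h3 => (h3 ⟨e, h, rfl⟩).elim⟩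
  intro W hW
  obtain ⟨B, hB⟩ := mem_atTop_sets.1 (hl hW)
  have hb : max (max a a') (ENNReal.ofReal B) < ⊤ := by simp [ha, ha']
  rw [mem_map, mem_nhdsWithin]
  refine ⟨endNhd h hb, isOpen_endNhd h hb, ⟨rfl, by simpa [terminus, h] using And.intro ha ha'⟩, ?_⟩
  rintro y ⟨hy, hy'⟩
  obtain ⟨t, ht, rfl⟩ := exists_of_mem_endNhd h hb hy
  have htop : (t : ℝ≥0∞) < ⊤ := by
    refine lt_top_iff_ne_top.2 fun h3 => hy' ⟨e, h, ?_⟩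
    congr 1
    exact Subtype.ext (by simp [terminus, h, h3])
  simp only [max_lt_iff] at ht
  have h3 : B ≤ (t : ℝ≥0∞).toReal := by
    exact (ENNReal.ofReal_le_iff_le_toReal htop.ne).1 ht.2.le
  have h4 := hB _ h3
  rw [mem_preimage, h1 t ht.1.1 htop, h2 t ht.1.2 htop, ← EReal.coe_add]
  have h5 : (m * (t : ℝ≥0∞).toReal + c + (m' * (t : ℝ≥0∞).toReal + c') : ℝ) =
      ((m + m' : ℤ) : ℝ) * (t : ℝ≥0∞).toReal + (c + c') := by
    push_cast
    ring
  rw [h5]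
  exact h4

/-- If each interval avoiding `S` can be cut by one further point, then finitely many further
points suffice. -/
lemma exists_finset_refine (S : Finset ℝ≥0∞) (P : ℝ≥0∞ → ℝ≥0∞ → Prop)
    (hP' : ∀ a b, b ≤ a → P a b)
    (hS : ∀ a b, (∀ s ∈ S, s ∉ Ioo a b) → ∃ w, ∀ a' b', a ≤ a' → b' ≤ b → w ∉ Ioo a' b' → P a' b') :
    ∃ S' : Finset ℝ≥0∞, ∀ a b, (∀ s ∈ S', s ∉ Ioo a b) → P a b := by
  classical
  let w : ℝ≥0∞ × ℝ≥0∞ → ℝ≥0∞ := fun p =>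
    if h : (∀ s ∈ S, s ∉ Ioo p.1 p.2) then (hS p.1 p.2 h).choose else 0
  let T : Finset ℝ≥0∞ := insert 0 (insert ⊤ S)
  refine ⟨S ∪ (T ×ˢ T).image w, fun a b hab => ?_⟩
  rcases le_or_gt b a with h | h
  · exact hP' a b h
  have h1 : (T.filter (fun s : ℝ≥0∞ => s ≤ a)).Nonempty := ⟨0, by simp [T]⟩
  have h2 : (T.filter (fun s : ℝ≥0∞ => b ≤ s)).Nonempty := ⟨⊤, by simp [T]⟩
  have h3 := Finset.mem_filter.1 (Finset.max'_mem _ h1)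
  have h4 := Finset.mem_filter.1 (Finset.min'_mem _ h2)
  have h5 : ∀ s ∈ S, s ∉ Ioo ((T.filter (fun s : ℝ≥0∞ => s ≤ a)).max' h1)
      ((T.filter (fun s : ℝ≥0∞ => b ≤ s)).min' h2) := by
    rintro s hs ⟨h6, h7⟩
    refine hab s (Finset.mem_union_left _ hs) ⟨?_, ?_⟩
    · by_contra! h8
      exact absurd h6
        (Finset.le_max' (T.filter (fun s : ℝ≥0∞ => s ≤ a)) s (Finset.mem_filter.2 ⟨by simp [T, hs], h8⟩)).not_gt
    · by_contra! h8
      exact absurd h7 (Finset.min'_le _ s (Finset.mem_filter.2 ⟨by simp [T, hs], h8⟩)).not_gt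
  refine (hS _ _ h5).choose_spec a b h3.2 h4.2 ?_
  have h6 := hab (w ((T.filter (fun s : ℝ≥0∞ => s ≤ a)).max' h1, (T.filter (fun s : ℝ≥0∞ => b ≤ s)).min' h2))
    (Finset.mem_union_right _ (Finset.mem_image_of_mem _ (Finset.mem_product.2 ⟨h3.1, h4.1⟩)))
  simp only [w] at h6
  rwa [dif_pos h5] at h6

lemma IsPiecewiseAffine.max {f g : Γ.Pt → EReal} (hf : IsPiecewiseAffine f)
    (hg : IsPiecewiseAffine g) : IsPiecewiseAffine (fun x => max (f x) (g x)) := by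
  classical
  intro e
  obtain ⟨S, hS⟩ := hf e
  obtain ⟨S', hS'⟩ := hg e
  refine exists_finset_refine (S ∪ S') _ ?_ ?_
  · intro a b hab
    exact ⟨0, 0, fun t h1 h2 => absurd (h1.trans h2) hab.not_gt⟩
  intro a b hab
  obtain ⟨m, c, h1⟩ := hS a b (fun s hs => hab s (Finset.mem_union_left _ hs))
  obtain ⟨m', c', h2⟩ := hS' a b (fun s hs => hab s (Finset.mem_union_right _ hs))
  refine ⟨ENNReal.ofReal ((c' - c) / (m - m')), fun a' b' ha hb hw => ?_⟩
  -- on `(a', b')` the difference of the two affine functions has a constant sign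
  have hsign : (∀ t : Icc (0 : ℝ≥0∞) (Γ.len e), a' < t → (t : ℝ≥0∞) < b' →
      (m * (t : ℝ≥0∞).toReal + c : ℝ) ≤ m' * (t : ℝ≥0∞).toReal + c') ∨
      (∀ t : Icc (0 : ℝ≥0∞) (Γ.len e), a' < t → (t : ℝ≥0∞) < b' →
      (m' * (t : ℝ≥0∞).toReal + c' : ℝ) ≤ m * (t : ℝ≥0∞).toReal + c) := by
    rcases eq_or_ne m m' with rfl | hm
    · rcases le_total c c' with h | h
      · exact Or.inl fun t _ _ => by linarith
      · exact Or.inr fun t _ _ => by linarith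
    have hside : (∀ t : Icc (0 : ℝ≥0∞) (Γ.len e), a' < t → (t : ℝ≥0∞) < b' →
        (c' - c) / (m - m') ≤ (t : ℝ≥0∞).toReal) ∨
        (∀ t : Icc (0 : ℝ≥0∞) (Γ.len e), a' < t → (t : ℝ≥0∞) < b' →
        (t : ℝ≥0∞).toReal ≤ (c' - c) / (m - m')) := by
      by_cases h3 : a' < ENNReal.ofReal ((c' - c) / (m - m'))
      · right
        intro t _ h4
        have h5 : b' ≤ ENNReal.ofReal ((c' - c) / (m - m')) := by
          by_contra! h6
          exact hw ⟨h3, h6⟩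
        have h6 := ENNReal.toReal_mono ENNReal.ofReal_ne_top (h4.trans_le h5).le
        have h7 : 0 < ENNReal.ofReal ((c' - c) / (m - m')) := (zero_le).trans_lt h3
        rwa [ENNReal.toReal_ofReal (ENNReal.ofReal_pos.1 h7).le] at h6
      · left
        intro t h4 h5
        exact (ENNReal.ofReal_le_iff_le_toReal (h5.trans_le le_top).ne).1
          ((not_lt.1 h3).trans h4.le)
    have hm' : ((m : ℝ) - m') ≠ 0 := sub_ne_zero.2 (by exact_mod_cast hm)
    have hq : ((m : ℝ) - m') * ((c' - c) / (m - m')) = c' - c := by field_simp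
    rcases lt_or_gt_of_ne hm' with h0 | h0 <;> rcases hside with h | h
    · exact Or.inl fun t h1 h2 => by nlinarith [h t h1 h2]
    · exact Or.inr fun t h1 h2 => by nlinarith [h t h1 h2]
    · exact Or.inr fun t h1 h2 => by nlinarith [h t h1 h2]
    · exact Or.inl fun t h1 h2 => by nlinarith [h t h1 h2]
  rcases hsign with h | h
  · refine ⟨m', c', fun t h3 h4 => ?_⟩
    beta_reduce
    rw [h1 t (ha.trans_lt h3) (h4.trans_le hb), h2 t (ha.trans_lt h3) (h4.trans_le hb)]
    exact max_eq_right (EReal.coe_le_coe_iff.2 (h t h3 h4))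
  · refine ⟨m, c, fun t h3 h4 => ?_⟩
    beta_reduce
    rw [h1 t (ha.trans_lt h3) (h4.trans_le hb), h2 t (ha.trans_lt h3) (h4.trans_le hb)]
    exact max_eq_left (EReal.coe_le_coe_iff.2 (h t h3 h4))

variable (Γ)

/-- The set `Rat(Γ)` of all rational functions on the tropical curve. -/
def RatFun : Type u := {f : Γ.Pt → EReal // IsRational f}

variable {Γ}

namespace RatFun

instance : FunLike Γ.RatFun Γ.Pt EReal where
  coe f := f.1
  coe_injective _ _ h := Subtype.ext h

lemma isRational (f : Γ.RatFun) : IsRational f := f.2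

lemma continuous (f : Γ.RatFun) : Continuous f := f.2.1

/-- Rational functions are determined by their values at finite points. -/
lemma ext_finite {f g : Γ.RatFun} (h : ∀ x, ¬ IsInfinite x → f x = g x) : f = g :=
  DFunLike.coe_injective (f.continuous.ext_on dense_finite g.continuous h)

variable (Γ) in
/-- The constant function with value the real number `c`. -/
noncomputable def const (c : ℝ) : Γ.RatFun :=
  ⟨fun _ => (c : EReal), continuous_const,
    Or.inr ⟨fun _ _ => ⟨EReal.coe_ne_bot c, EReal.coe_ne_top c⟩,
      fun _ => ⟨∅, fun _ _ _ => ⟨0, c, fun _ _ _ => by simp⟩⟩⟩⟩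

/-- The zero of the semifield is the constant function `-∞`. -/
noncomputable instance : Zero Γ.RatFun := ⟨⟨fun _ => ⊥, continuous_const, Or.inl fun _ => rfl⟩⟩

/-- The one of the semifield is the constant function with value the real number zero. -/
noncomputable instance : One Γ.RatFun := ⟨const Γ 0⟩

/-- Tropical addition is the pointwise maximum. -/
noncomputable instance : Add Γ.RatFun :=
  ⟨fun f g => ⟨fun x => max (f x) (g x), f.continuous.max g.continuous, by
    rcases f.2.2 with hf | ⟨hf, hfp⟩
    · rcases g.2.2 with hg | hg
      · exact Or.inl fun x => by
          change max (f.1 x) (g.1 x) = ⊥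
          rw [hf, hg, max_self]
      · right
        have h : (fun x => max (f x) (g x)) = g.1 := by
          funext x
          change max (f.1 x) (g.1 x) = g.1 x
          rw [hf]
          exact max_eq_right bot_le
        rw [h]
        exact hg
    · right
      rcases g.2.2 with hg | ⟨hg, hgp⟩
      · have h : (fun x => max (f x) (g x)) = f.1 := by
          funext x
          change max (f.1 x) (g.1 x) = f.1 x
          rw [hg]
          exact max_eq_left bot_le
        rw [h]
        exact ⟨hf, hfp⟩
      · refine ⟨fun x hx => ?_, hfp.max hgp⟩
        beta_reduce
        rcases max_choice (f x) (g x) with h | h <;> rw [h]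
        exacts [hf x hx, hg x hx]⟩⟩

lemma tendsto_add_of_finite (f g : Γ.RatFun) {x : Γ.Pt} (hx : ¬ IsInfinite x) :
    Tendsto (fun y => f y + g y) (𝓝[{y : Γ.Pt | ¬ IsInfinite y}] x) (𝓝 (f x + g x)) := by
  obtain ⟨l, h1, h2⟩ := exists_tendsto_add f.2 g.2 x
  rw [h2 hx] at h1
  exact h1

lemma extendFrom_add (f g : Γ.RatFun) {x : Γ.Pt} (hx : ¬ IsInfinite x) :
    extendFrom {y : Γ.Pt | ¬ IsInfinite y} (fun y => f y + g y) x = f x + g x :=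
  extendFrom_eq (subset_closure hx) (tendsto_add_of_finite f g hx)

/-- Tropical multiplication is the sum at finite points, extended by continuity to the points at
infinity. -/
noncomputable instance : Mul Γ.RatFun :=
  ⟨fun f g => ⟨extendFrom {y : Γ.Pt | ¬ IsInfinite y} (fun y => f y + g y), by
    have hc : Continuous (extendFrom {y : Γ.Pt | ¬ IsInfinite y} (fun y => f y + g y)) :=
      continuous_extendFrom dense_finite fun x => by
        obtain ⟨l, h1, -⟩ := exists_tendsto_add f.2 g.2 x
        exact ⟨l, h1⟩
    refine ⟨hc, ?_⟩
    rcases f.2.2 with hf | ⟨hf, hfp⟩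
    · refine Or.inl (congrFun (hc.ext_on dense_finite (continuous_const (y := ⊥)) ?_))
      intro x hx
      rw [extendFrom_add f g hx]
      change f.1 x + _ = _
      simp [hf]
    rcases g.2.2 with hg | ⟨hg, hgp⟩
    · refine Or.inl (congrFun (hc.ext_on dense_finite (continuous_const (y := ⊥)) ?_))
      intro x hx
      rw [extendFrom_add f g hx]
      change _ + g.1 x = _
      simp [hg]
    refine Or.inr ⟨fun x hx => ?_, fun e => ?_⟩
    · rw [extendFrom_add f g hx]
      exact ⟨by simpa [EReal.add_eq_bot_iff] using ⟨(hf x hx).1, (hg x hx).1⟩,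
        EReal.add_ne_top (hf x hx).2 (hg x hx).2⟩
    · classical
      obtain ⟨S, hS⟩ := hfp e
      obtain ⟨S', hS'⟩ := hgp e
      refine ⟨S ∪ S', fun a b hab => ?_⟩
      obtain ⟨m, c, h1⟩ := hS a b (fun s hs => hab s (Finset.mem_union_left _ hs))
      obtain ⟨m', c', h2⟩ := hS' a b (fun s hs => hab s (Finset.mem_union_right _ hs))
      refine ⟨m + m', c + c', fun t h3 h4 => ?_⟩
      rw [extendFrom_add f g (not_isInfinite_pt (h4.trans_le le_top))]
      change f.1 _ + g.1 _ = _
      rw [h1 t h3 h4, h2 t h3 h4, ← EReal.coe_add]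
      congr 1
      push_cast
      ring⟩⟩

lemma add_apply (f g : Γ.RatFun) (x : Γ.Pt) : (f + g) x = max (f x) (g x) := rfl

lemma mul_apply (f g : Γ.RatFun) {x : Γ.Pt} (hx : ¬ IsInfinite x) : (f * g) x = f x + g x :=
  extendFrom_add f g hx

lemma zero_apply (x : Γ.Pt) : (0 : Γ.RatFun) x = ⊥ := rfl

lemma one_apply (x : Γ.Pt) : (1 : Γ.RatFun) x = 0 := rfl

/-- The semiring `Rat(Γ)`. -/
noncomputable instance : CommSemiring Γ.RatFun where
  nsmul := nsmulRec
  add_assoc f g h := ext_finite fun x _ => by simp only [add_apply, max_assoc]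
  zero_add f := ext_finite fun x _ => by simp [add_apply, zero_apply]
  add_zero f := ext_finite fun x _ => by simp [add_apply, zero_apply]
  add_comm f g := ext_finite fun x _ => by simp only [add_apply, max_comm]
  mul_assoc f g h := ext_finite fun x hx => by simp only [mul_apply _ _ hx, add_assoc]
  one_mul f := ext_finite fun x hx => by simp only [mul_apply _ _ hx, one_apply, zero_add]
  mul_one f := ext_finite fun x hx => by simp only [mul_apply _ _ hx, one_apply, add_zero]
  mul_comm f g := ext_finite fun x hx => by simp only [mul_apply _ _ hx, add_comm]
  zero_mul f := ext_finite fun x hx => by simp only [mul_apply _ _ hx, zero_apply, EReal.bot_add]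
  mul_zero f := ext_finite fun x hx => by simp only [mul_apply _ _ hx, zero_apply, EReal.add_bot]
  left_distrib f g h := ext_finite fun x hx => by
    simp only [mul_apply _ _ hx, add_apply]
    exact (max_add_add_left _ _ _).symm
  right_distrib f g h := ext_finite fun x hx => by
    simp only [mul_apply _ _ hx, add_apply]
    exact (max_add_add_right _ _ _).symm

end RatFun

/-- The chip-firing move `CF(A; l)`, that is `x ↦ -min(l, dist(x, A))`. -/
noncomputable def chipFiring (A : Set Γ.Pt) (l : ℝ≥0∞) (x : Γ.Pt) : EReal :=
  -((min l (⨅ a ∈ A, pdist x a) : ℝ≥0∞) : EReal)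

variable (Γ) in
/-- The part `(y, x]` of the edge `e`, where `y` is the point with coordinate `s` and `x` is the
end of `e`. -/
def tail (e : Γ.E) (s : Icc (0 : ℝ≥0∞) (Γ.len e)) : Set Γ.Pt := Γ.pt e '' Ioi s

end EdgeWeightedGraph

open EdgeWeightedGraph

/-- `φ` is an `r`-expansive map of tropical curves: a continuous bijection that restricts to a
bijection between the finite points which multiplies distances by `r`. -/
structure IsExpansive {Γ₁ : EdgeWeightedGraph.{u}} {Γ₂ : EdgeWeightedGraph.{v}} (r : ℝ)
    (φ : Γ₁.Pt → Γ₂.Pt) : Prop where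
  continuous : Continuous φ
  bijective : Function.Bijective φ
  isInfinite_iff : ∀ x, IsInfinite (φ x) ↔ IsInfinite x
  dist_eq : ∀ x y, ¬ IsInfinite x → ¬ IsInfinite y →
    ENNReal.ofReal r * pdist x y = pdist (φ x) (φ y)

/-- `φ` is the map of tropical curves induced by the semiring isomorphism `ψ` of rational function
semifields, where the real number `r` is the image under `ψ` of the real constant `1`.
A finite point `x` goes to the finite point `x'` such that `ψ` maps `CF({x}; ε)` to
`CF({x'}; r ε)` for some `ε > 0`.  A point at infinity `x` goes to the point at infinity `x'` such
that `ψ` maps `CF(Γ₁ \ (y, x]; ∞)` to `CF(Γ₂ \ (y', x']; ∞)` for some finite point `y` on the edge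
of `x` whose image `y'` is on the edge of `x'`. -/
structure IsInducedBy {Γ₁ : EdgeWeightedGraph.{u}} {Γ₂ : EdgeWeightedGraph.{v}}
    (ψ : Γ₁.RatFun ≃+* Γ₂.RatFun) (r : ℝ) (φ : Γ₁.Pt → Γ₂.Pt) : Prop where
  finite : ∀ x, ¬ IsInfinite x → ¬ IsInfinite (φ x) ∧
    ∃ ε : ℝ, 0 < ε ∧ ∃ f : Γ₁.RatFun, ⇑f = chipFiring {x} (ENNReal.ofReal ε) ∧
      ⇑(ψ f) = chipFiring {φ x} (ENNReal.ofReal (r * ε))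
  infinite : ∀ e : Γ₁.E, Γ₁.len e = ⊤ → ∃ e' : Γ₂.E, Γ₂.len e' = ⊤ ∧
    φ (Γ₁.pt e (Γ₁.terminus e)) = Γ₂.pt e' (Γ₂.terminus e') ∧
    ∃ (s : Icc (0 : ℝ≥0∞) (Γ₁.len e)) (s' : Icc (0 : ℝ≥0∞) (Γ₂.len e')),
      (s : ℝ≥0∞) < ⊤ ∧ (s' : ℝ≥0∞) < ⊤ ∧ φ (Γ₁.pt e s) = Γ₂.pt e' s' ∧
      ∃ f : Γ₁.RatFun, ⇑f = chipFiring (Γ₁.tail e s)ᶜ ⊤ ∧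
        ⇑(ψ f) = chipFiring (Γ₂.tail e' s')ᶜ ⊤

/-! The isomorphism `ψ` is shown to be a rescaled change of variable, by recovering first the
constants, then the points, then the distance from the semiring structure.

Constants: a nonzero function with roots of every order has slopes divisible by every integer, hence
zero slopes, and is constant because the graph is connected (`exists_eq_const_of_divisible`). So `ψ`
maps real constants to real constants. On them it preserves sum and maximum, so it is additive and
monotone, that is, multiplication by some `r > 0` (`exists_scale`).

Points: for `y` in `Γ₂` there is an `x` with `ψ f y = r * f x` for all `f` (`exists_eval_eq`).
Otherwise every `x` has an `f` with `ψ f y < r * f x`; after shifts by constants and a maximum over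
a finite cover, compactness yields `h ≥ 0` with `ψ h y < 0`. But `h ≥ 0` is the identity `h + 1 =
h`, which `ψ` preserves. Chip-firing moves are rational and separate points (`exists_ratFun_ne`), so
the evaluations for `ψ` and its inverse give mutually inverse bijections (`exists_compat`). The
formula for `ψ f` is then immediate, and everything else is deduced from it.

Distance: `ψ` of a small chip-firing move at `x` is nonpositive and vanishes only at `φ x`. Its
slopes leaving `φ x` are negative integers, hence at most `-1`, so it lies below a chip-firing move
at `φ x` (`exists_le_chipFiring`). Read at `φ z`, this bounds the distance from `φ z` to `φ x` by
`r` times that from `z` to `x`, for `z` near `x`. Continuous induction along edges and summation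
over chains make the bound global, and the inverse isomorphism gives the reverse bound
(`Compat.pdist_eq`).

Since `φ` scales distances, it carries chip-firing moves to chip-firing moves; sublevel sets match
the tails of infinite edges (`exists_image_tail_eq`). Uniqueness holds because the moves in question
have a single zero, respectively a single point with value `-∞`. -/

namespace EdgeWeightedGraph

/-! ### Coordinates, chains and compactness. -/

variable {Γ : EdgeWeightedGraph.{u}}

/-- Two coordinates of the same point coincide, or both of them are ends of edges. -/
lemma eq_or_end_of_pt_eq {e e' : Γ.E} {s : Icc (0 : ℝ≥0∞) (Γ.len e)}
    {s' : Icc (0 : ℝ≥0∞) (Γ.len e')} (h : Γ.pt e s = Γ.pt e' s') :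
    (⟨e, s⟩ : Σ e : Γ.E, Icc (0 : ℝ≥0∞) (Γ.len e)) = ⟨e', s'⟩ ∨
      (s' : ℝ≥0∞) = 0 ∨ (s' : ℝ≥0∞) = Γ.len e' := by
  by_contra! hc
  obtain ⟨hne, h0, h1⟩ := hc
  let Q : Γ.Pt → Prop := Quot.lift (fun p : Γ.PrePt => match p with
    | Sum.inl _ => False
    | Sum.inr q => q = ⟨e', s'⟩) (by
      rintro _ _ (e₁ | e₁)
      · simp only [eq_iff_iff, iff_false]
        intro h2
        obtain ⟨rfl, h3⟩ := Sigma.mk.inj_iff.1 h2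
        obtain rfl := eq_of_heq h3
        exact h0 rfl
      · simp only [eq_iff_iff, iff_false]
        intro h2
        obtain ⟨rfl, h3⟩ := Sigma.mk.inj_iff.1 h2
        obtain rfl := eq_of_heq h3
        exact h1 rfl)
  have h2 : Q (Γ.pt e' s') := rfl
  rw [← h] at h2
  exact hne h2

lemma eq_or_end_of_pt_eq_same {e : Γ.E} {s s' : Icc (0 : ℝ≥0∞) (Γ.len e)}
    (h : Γ.pt e s = Γ.pt e s') :
    s = s' ∨ ((s : ℝ≥0∞) = 0 ∨ (s : ℝ≥0∞) = Γ.len e) ∧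
      ((s' : ℝ≥0∞) = 0 ∨ (s' : ℝ≥0∞) = Γ.len e) := by
  rcases eq_or_end_of_pt_eq h with h1 | h1
  · exact Or.inl (eq_of_heq (Sigma.mk.inj_iff.1 h1).2)
  rcases eq_or_end_of_pt_eq h.symm with h2 | h2
  · exact Or.inl (eq_of_heq (Sigma.mk.inj_iff.1 h2).2).symm
  exact Or.inr ⟨h2, h1⟩

lemma coe_lt_top_of_not_isInfinite {e : Γ.E} {s : Icc (0 : ℝ≥0∞) (Γ.len e)}
    (h : ¬ IsInfinite (Γ.pt e s)) : (s : ℝ≥0∞) < ⊤ := by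
  refine lt_top_iff_ne_top.2 fun h3 => h ⟨e, top_le_iff.1 (h3 ▸ s.2.2), ?_⟩
  congr 1
  exact Subtype.ext (le_antisymm s.2.2 (h3 ▸ le_top))

/-! Chains and distances. -/

lemma ChainLength.trans {x y z : Γ.Pt} {L M : ℝ≥0∞} (h : ChainLength x y L)
    (h' : ChainLength y z M) : ChainLength x z (L + M) := by
  induction h with
  | refl => simpa using h'
  | step e s t y L _ ih =>
    rw [add_assoc]
    exact .step e s t z _ (ih h')

lemma ChainLength.single (e : Γ.E) (s t : Icc (0 : ℝ≥0∞) (Γ.len e)) :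
    ChainLength (Γ.pt e s) (Γ.pt e t) (((s : ℝ≥0∞) - t) + ((t : ℝ≥0∞) - s)) := by
  simpa using ChainLength.step e s t _ 0 (.refl _)

lemma ChainLength.symm {x y : Γ.Pt} {L : ℝ≥0∞} (h : ChainLength x y L) : ChainLength y x L := by
  induction h with
  | refl => exact .refl _
  | step e s t y L _ ih =>
    have := ih.trans (ChainLength.single e t s)
    rwa [add_comm, add_comm ((t : ℝ≥0∞) - s)] at this

lemma pdist_comm (x y : Γ.Pt) : pdist x y = pdist y x := by
  unfold pdist
  congr 1
  ext L
  exact ⟨fun h => h.symm, fun h => h.symm⟩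

lemma pdist_le {x y : Γ.Pt} {L : ℝ≥0∞} (h : ChainLength x y L) : pdist x y ≤ L := sInf_le h

@[simp] lemma pdist_self (x : Γ.Pt) : pdist x x = 0 := nonpos_iff_eq_zero.1 (pdist_le (.refl x))

lemma pdist_triangle (x y z : Γ.Pt) : pdist x z ≤ pdist x y + pdist y z := by
  unfold pdist
  rw [ENNReal.sInf_add]
  refine le_iInf₂ fun L hL => ?_
  rw [add_comm, ENNReal.sInf_add]
  refine le_iInf₂ fun M hM => ?_
  rw [add_comm]
  exact sInf_le (ChainLength.trans hL hM)

lemma pdist_pt_le (e : Γ.E) (s t : Icc (0 : ℝ≥0∞) (Γ.len e)) :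
    pdist (Γ.pt e s) (Γ.pt e t) ≤ ((s : ℝ≥0∞) - t) + ((t : ℝ≥0∞) - s) :=
  pdist_le (.single e s t)

/-! A real parametrization of the finite part of an edge. -/

variable (Γ) in
/-- The coordinate `t` on the edge `e`, cut off at the ends of the edge. -/
noncomputable def clamp (e : Γ.E) (t : ℝ) : Icc (0 : ℝ≥0∞) (Γ.len e) :=
  ⟨min (ENNReal.ofReal t) (Γ.len e), zero_le, min_le_right _ _⟩

lemma clamp_lt_top (e : Γ.E) (t : ℝ) : (Γ.clamp e t : ℝ≥0∞) < ⊤ :=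
  (min_le_left _ _).trans_lt ENNReal.ofReal_lt_top

lemma continuous_clamp (e : Γ.E) : Continuous (Γ.clamp e) := by
  unfold clamp
  have := ENNReal.continuous_ofReal
  fun_prop

lemma clamp_toReal {e : Γ.E} (s : Icc (0 : ℝ≥0∞) (Γ.len e)) (hs : (s : ℝ≥0∞) < ⊤) :
    Γ.clamp e (s : ℝ≥0∞).toReal = s :=
  Subtype.ext (by simp [clamp, ENNReal.ofReal_toReal hs.ne, s.2.2])

variable (Γ) in
/-- The point with coordinate `t` on the edge `e`, where `t` is cut off at the ends. -/
noncomputable def rpt (e : Γ.E) (t : ℝ) : Γ.Pt := Γ.pt e (Γ.clamp e t)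

lemma not_isInfinite_rpt (e : Γ.E) (t : ℝ) : ¬ IsInfinite (Γ.rpt e t) :=
  not_isInfinite_pt (clamp_lt_top e t)

lemma continuous_rpt (e : Γ.E) : Continuous (Γ.rpt e) :=
  (continuous_pt e).comp (continuous_clamp e)

lemma pdist_rpt_le_of_le (e : Γ.E) {s t : ℝ} (h : s ≤ t) :
    pdist (Γ.rpt e s) (Γ.rpt e t) ≤ ENNReal.ofReal (t - s) := by
  refine (pdist_pt_le _ _ _).trans ?_
  have h1 : ENNReal.ofReal s ≤ ENNReal.ofReal t := ENNReal.ofReal_le_ofReal h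
  have h2 : (Γ.clamp e s : ℝ≥0∞) ≤ Γ.clamp e t := min_le_min_right _ h1
  rw [tsub_eq_zero_of_le h2, zero_add, tsub_le_iff_right]
  have h3 : ENNReal.ofReal t ≤ ENNReal.ofReal (t - s) + ENNReal.ofReal s := by
    refine le_trans (le_of_eq ?_) ENNReal.ofReal_add_le
    simp
  change min _ _ ≤ _ + min _ _
  rw [← min_add_add_left]
  exact min_le_min h3 le_add_self

lemma pdist_rpt_le (e : Γ.E) (s t : ℝ) :
    pdist (Γ.rpt e s) (Γ.rpt e t) ≤ ENNReal.ofReal |t - s| := by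
  rcases le_total s t with h | h
  · rw [abs_of_nonneg (sub_nonneg.2 h)]
    exact pdist_rpt_le_of_le e h
  · rw [pdist_comm, abs_sub_comm, abs_of_nonneg (sub_nonneg.2 h)]
    exact pdist_rpt_le_of_le e h

lemma pt_src (e : Γ.E) : Γ.pt e (Γ.origin e) = Quot.mk _ (Sum.inl (Γ.src e)) :=
  Quot.sound (Glue.src e)

lemma pt_tgt (e : Γ.E) : Γ.pt e (Γ.terminus e) = Quot.mk _ (Sum.inl (Γ.tgt e)) :=
  Quot.sound (Glue.tgt e)

/-- A finite union of points and compact intervals. Covers of this space, rather than of the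
quotient, allow local arguments on one edge at a time. -/
instance : CompactSpace Γ.PrePt := by
  have := Γ.finite_V
  have := Γ.finite_E
  infer_instance

instance : CompactSpace Γ.Pt := inferInstanceAs (CompactSpace (Quot Γ.Glue))

instance : Nonempty Γ.Pt := ⟨Quot.mk _ (Sum.inl Γ.nonempty_V.some)⟩

lemma exists_finite (Γ : EdgeWeightedGraph.{u}) : ∃ x : Γ.Pt, ¬ IsInfinite x :=
  dense_finite.nonempty

/-- A function on a tropical curve is continuous if it is so on each edge. -/
lemma continuous_of_edges {X : Type*} [TopologicalSpace X] {f : Γ.Pt → X}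
    (h : ∀ e, Continuous fun t => f (Γ.pt e t)) : Continuous f := by
  have hq : IsQuotientMap (Quot.mk Γ.Glue) := isQuotientMap_quot_mk
  refine hq.continuous_iff.2 (continuous_sum_dom.2 ⟨continuous_of_discreteTopology, ?_⟩)
  exact continuous_sigma h

end EdgeWeightedGraph

/-! ### Inverses, slopes and divisible rational functions. -/

namespace EdgeWeightedGraph

variable {Γ : EdgeWeightedGraph.{u}}

namespace RatFun

lemma eq_zero_of_forall {f : Γ.RatFun} (h : ∀ x, f x = ⊥) : f = 0 :=
  DFunLike.coe_injective (funext h)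

lemma regular_of_ne_zero {f : Γ.RatFun} (hf : f ≠ 0) :
    (∀ x, ¬ IsInfinite x → f x ≠ ⊥ ∧ f x ≠ ⊤) ∧ IsPiecewiseAffine f :=
  f.2.2.resolve_left fun h => hf (eq_zero_of_forall h)

lemma coe_toReal {f : Γ.RatFun} (hf : f ≠ 0) {x : Γ.Pt} (hx : ¬ IsInfinite x) :
    ((f x).toReal : EReal) = f x :=
  EReal.coe_toReal ((regular_of_ne_zero hf).1 x hx).2 ((regular_of_ne_zero hf).1 x hx).1

lemma const_apply (c : ℝ) (x : Γ.Pt) : const Γ c x = c := rfl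

lemma const_ne_zero (c : ℝ) : const Γ c ≠ 0 := by
  intro h
  have := DFunLike.congr_fun h (Classical.arbitrary Γ.Pt)
  exact EReal.coe_ne_bot c this

lemma const_injective : Function.Injective (const Γ) := by
  intro a b h
  have := DFunLike.congr_fun h (Classical.arbitrary Γ.Pt)
  exact EReal.coe_injective this

lemma one_eq_const : (1 : Γ.RatFun) = const Γ 0 := rfl

lemma const_mul_const (a b : ℝ) : const Γ a * const Γ b = const Γ (a + b) :=
  ext_finite fun x hx => by simp only [mul_apply _ _ hx, const_apply, EReal.coe_add]

lemma const_pow (a : ℝ) (n : ℕ) : const Γ a ^ n = const Γ (n * a) := by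
  induction n with
  | zero => simp [one_eq_const]
  | succ n ih =>
    rw [pow_succ, ih, const_mul_const]
    congr 1
    push_cast
    ring

lemma const_add_const (a b : ℝ) : const Γ a + const Γ b = const Γ (max a b) :=
  ext_finite fun x _ => by
    simp only [add_apply, const_apply]
    exact (EReal.coe_strictMono.monotone.map_max).symm

/-- Adding a real number is continuous on all of `EReal`, so for a constant factor the pointwise
formula persists at points at infinity. -/
lemma const_mul_apply (c : ℝ) (f : Γ.RatFun) (x : Γ.Pt) : (const Γ c * f) x = c + f x := by
  have h : Continuous fun x => (c : EReal) + f x := by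
    refine continuous_iff_continuousAt.2 fun x => ?_
    have h1 : ContinuousAt (fun p : EReal × EReal => p.1 + p.2) (c, f x) :=
      EReal.continuousAt_add (Or.inl (EReal.coe_ne_top c)) (Or.inl (EReal.coe_ne_bot c))
    exact h1.tendsto.comp (tendsto_const_nhds.prodMk_nhds (f.continuous.tendsto x))
  exact congrFun ((const Γ c * f).continuous.ext_on dense_finite h fun x hx => by
    rw [mul_apply _ _ hx, const_apply]) x

/-- A nonzero rational function has an inverse. -/
lemma exists_inverse {f : Γ.RatFun} (hf : f ≠ 0) :
    ∃ g : Γ.RatFun, g ≠ 0 ∧ f * g = 1 ∧ ∀ x, g x = -f x := by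
  obtain ⟨h1, h2⟩ := regular_of_ne_zero hf
  have h3 : ∀ x, ¬ IsInfinite x → -f x ≠ ⊥ ∧ -f x ≠ ⊤ := fun x hx =>
    ⟨fun h => (h1 x hx).2 (EReal.neg_eq_bot_iff.1 h),
      fun h => (h1 x hx).1 (EReal.neg_eq_top_iff.1 h)⟩
  refine ⟨⟨fun x => -f x, f.continuous.neg, Or.inr ⟨h3, fun e => ?_⟩⟩, ?_, ?_, fun x => rfl⟩
  · obtain ⟨S, hS⟩ := h2 e
    refine ⟨S, fun a b hab => ?_⟩
    obtain ⟨m, c, h⟩ := hS a b hab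
    refine ⟨-m, -c, fun t ht ht' => ?_⟩
    beta_reduce
    rw [h t ht ht', ← EReal.coe_neg]
    congr 1
    push_cast
    ring
  · intro h
    obtain ⟨x, hx⟩ := exists_finite Γ
    exact (h3 x hx).1 (DFunLike.congr_fun h x)
  · refine ext_finite fun x hx => ?_
    refine (mul_apply _ _ hx).trans ?_
    change f x + -f x = 0
    rw [← coe_toReal hf hx, ← EReal.coe_neg, ← EReal.coe_add]
    simp

lemma eq_neg_of_mul_eq_one {f g : Γ.RatFun} (h : f * g = 1) (x : Γ.Pt) : g x = -f x := by
  have hf : f ≠ 0 := by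
    rintro rfl
    rw [zero_mul] at h
    exact const_ne_zero 0 h.symm
  obtain ⟨g', -, h1, h2⟩ := exists_inverse hf
  have h3 : g = g' := left_inv_eq_right_inv (a := f) (by rw [mul_comm, h]) h1
  rw [h3, h2]

/-- The values of a rational function on an edge, as a function of a real parameter. -/
noncomputable def edgeVal (f : Γ.RatFun) (e : Γ.E) (t : ℝ) : ℝ := (f (Γ.rpt e t)).toReal

lemma coe_edgeVal {f : Γ.RatFun} (hf : f ≠ 0) (e : Γ.E) (t : ℝ) :
    (edgeVal f e t : EReal) = f (Γ.rpt e t) :=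
  coe_toReal hf (not_isInfinite_rpt e t)

lemma continuous_edgeVal {f : Γ.RatFun} (hf : f ≠ 0) (e : Γ.E) : Continuous (edgeVal f e) := by
  refine continuous_iff_continuousAt.2 fun t => ?_
  have h := (regular_of_ne_zero hf).1 _ (not_isInfinite_rpt e t)
  exact (EReal.tendsto_toReal h.2 h.1).comp
    ((f.continuous.comp (continuous_rpt e)).tendsto t)

lemma exists_break_points {f : Γ.RatFun} (hf : f ≠ 0) (e : Γ.E) :
    ∃ S : Finset ℝ, ∀ a b : ℝ, a < b → (∀ s ∈ S, s ∉ Ioo a b) →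
      ∃ (m : ℤ) (c : ℝ), ∀ t ∈ Icc a b, edgeVal f e t = m * t + c := by
  classical
  obtain ⟨S, hS⟩ := (regular_of_ne_zero hf).2 e
  -- The clamped parametrization is constant left of `0` and right of a finite length. With both as
  -- break points, an interval lies in a constant region or inside the edge. `toReal` sends `⊤` to
  -- `0`, which is a break point anyway.
  refine ⟨insert 0 (insert (Γ.len e).toReal (S.image ENNReal.toReal)), fun a b hab h => ?_⟩
  have h0 := h 0 (by simp)
  rcases le_or_gt b 0 with hb | hb
  · refine ⟨0, edgeVal f e 0, fun t ht => ?_⟩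
    have h1 : Γ.clamp e t = Γ.clamp e 0 :=
      Subtype.ext (by simp [clamp, ENNReal.ofReal_of_nonpos (ht.2.trans hb)])
    simp [edgeVal, rpt, h1]
  have ha : 0 ≤ a := by
    by_contra! h1
    exact h0 ⟨h1, hb⟩
  by_cases hlen : Γ.len e ≠ ⊤ ∧ (Γ.len e).toReal ≤ a
  · refine ⟨0, edgeVal f e a, fun t ht => ?_⟩
    have h2 : ∀ t, a ≤ t → (Γ.clamp e t : ℝ≥0∞) = Γ.len e := fun t ht => min_eq_right
      ((ENNReal.le_ofReal_iff_toReal_le hlen.1 (ha.trans ht)).2 (hlen.2.trans ht))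
    have h1 : Γ.clamp e t = Γ.clamp e a :=
      Subtype.ext (by rw [h2 t ht.1, h2 a le_rfl])
    simp [edgeVal, rpt, h1]
  have hlen' : ENNReal.ofReal b ≤ Γ.len e := by
    by_cases h1 : Γ.len e = ⊤
    · simp [h1]
    have h2 := h (Γ.len e).toReal (by simp)
    refine ENNReal.ofReal_le_of_le_toReal ?_
    by_contra! h3
    exact h2 ⟨not_le.1 fun h4 => hlen ⟨h1, h4⟩, h3⟩
  obtain ⟨m, c, hmc⟩ := hS (ENNReal.ofReal a) (ENNReal.ofReal b) (by
    rintro s hs ⟨h1, h2⟩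
    have h3 : s ≠ ⊤ := (h2.trans ENNReal.ofReal_lt_top).ne
    refine h s.toReal (Finset.mem_insert_of_mem (Finset.mem_insert_of_mem
      (Finset.mem_image_of_mem _ hs))) ⟨?_, ?_⟩
    · exact (ENNReal.ofReal_lt_iff_lt_toReal ha h3).1 h1
    · exact (ENNReal.lt_ofReal_iff_toReal_lt h3).1 h2)
  refine ⟨m, c, ?_⟩
  have h1 : EqOn (edgeVal f e) (fun t => m * t + c) (Ioo a b) := by
    intro t ht
    have h2 : (Γ.clamp e t : ℝ≥0∞) = ENNReal.ofReal t :=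
      min_eq_left ((ENNReal.ofReal_le_ofReal ht.2.le).trans hlen')
    have h3 := hmc (Γ.clamp e t) (h2 ▸ (ENNReal.ofReal_lt_ofReal_iff (ha.trans_lt ht.1)).2 ht.1)
      (h2 ▸ (ENNReal.ofReal_lt_ofReal_iff hb).2 ht.2)
    rw [edgeVal, rpt, h3, h2, EReal.toReal_coe, ENNReal.toReal_ofReal (ha.trans ht.1.le)]
  have h2 := h1.closure (continuous_edgeVal hf e) (by fun_prop)
  rwa [closure_Ioo hab.ne] at h2

/-- A rational function has an integer slope in both directions at each point of an edge. -/
lemma exists_slopes {f : Γ.RatFun} (hf : f ≠ 0) (e : Γ.E) (t₀ : ℝ) :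
    ∃ (m n : ℤ) (δ : ℝ), 0 < δ ∧
      (∀ t ∈ Icc t₀ (t₀ + δ), edgeVal f e t = edgeVal f e t₀ + m * (t - t₀)) ∧
      (∀ t ∈ Icc (t₀ - δ) t₀, edgeVal f e t = edgeVal f e t₀ + n * (t₀ - t)) := by
  classical
  obtain ⟨S, hS⟩ := exists_break_points hf e
  have h1 : ((S.erase t₀ : Finset ℝ) : Set ℝ)ᶜ ∈ 𝓝 t₀ :=
    (S.erase t₀).finite_toSet.isClosed.isOpen_compl.mem_nhds (by simp)
  obtain ⟨δ, hδ, h2⟩ := Metric.mem_nhds_iff.1 h1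
  have h3 : ∀ s ∈ S, s ≠ t₀ → δ ≤ |s - t₀| := by
    intro s hs hne
    by_contra! h4
    exact h2 (Metric.mem_ball.2 h4) (by simp [hs, hne])
  obtain ⟨m, c, hm⟩ := hS t₀ (t₀ + δ) (by linarith) (by
    rintro s hs ⟨h4, h5⟩
    have := h3 s hs h4.ne'
    rw [abs_of_pos (by linarith)] at this
    linarith)
  obtain ⟨n, d, hn⟩ := hS (t₀ - δ) t₀ (by linarith) (by
    rintro s hs ⟨h4, h5⟩
    have := h3 s hs h5.ne
    rw [abs_of_neg (by linarith)] at this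
    linarith)
  refine ⟨m, -n, δ, hδ, fun t ht => ?_, fun t ht => ?_⟩
  · rw [hm t ht, hm t₀ ⟨le_rfl, by linarith⟩]
    ring
  · rw [hn t ht, hn t₀ ⟨by linarith, le_rfl⟩]
    push_cast
    ring

lemma ne_zero_of_pow_ne_zero {h : Γ.RatFun} {n : ℕ} (hn : n ≠ 0) : h ^ n ≠ 0 → h ≠ 0 := by
  rintro h1 rfl
  exact h1 (zero_pow hn)

lemma edgeVal_mul {f g : Γ.RatFun} (hf : f ≠ 0) (hg : g ≠ 0) (e : Γ.E) (t : ℝ) :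
    edgeVal (f * g) e t = edgeVal f e t + edgeVal g e t := by
  unfold edgeVal
  have hx := not_isInfinite_rpt e t
  rw [mul_apply _ _ hx, ← coe_toReal hf hx, ← coe_toReal hg hx, ← EReal.coe_add]
  simp only [EReal.toReal_coe]

lemma mul_ne_zero' {f g : Γ.RatFun} (hf : f ≠ 0) (hg : g ≠ 0) : f * g ≠ 0 := by
  obtain ⟨f', -, h1, -⟩ := exists_inverse hf
  intro h
  refine hg ?_
  calc g = (f * f') * g := by rw [h1, one_mul]
    _ = (f * g) * f' := by ring
    _ = 0 := by rw [h, zero_mul]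

lemma edgeVal_pow {h : Γ.RatFun} (hh : h ≠ 0) (e : Γ.E) (t : ℝ) (n : ℕ) :
    h ^ n ≠ 0 ∧ edgeVal (h ^ n) e t = n * edgeVal h e t := by
  induction n with
  | zero => exact ⟨by rw [pow_zero]; exact const_ne_zero 0, by simp [edgeVal, one_apply]⟩
  | succ n ih =>
    rw [pow_succ]
    refine ⟨mul_ne_zero' ih.1 hh, ?_⟩
    rw [edgeVal_mul ih.1 hh, ih.2]
    push_cast
    ring

/-- The slopes of a divisible rational function vanish. -/
lemma edgeVal_eq_of_divisible {f : Γ.RatFun} (hf : f ≠ 0)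
    (hdiv : ∀ n : ℕ, n ≠ 0 → ∃ h : Γ.RatFun, h ^ n = f) (e : Γ.E) (t : ℝ) :
    edgeVal f e t = edgeVal f e 0 := by
  -- `σ = 1` and `σ = -1` select the two directions at `t₀`.
  have key : ∀ (t₀ δ σ : ℝ) (m : ℤ), 0 < δ →
      (∀ u ∈ Icc 0 δ, edgeVal f e (t₀ + σ * u) = edgeVal f e t₀ + m * u) →
      (∀ h : Γ.RatFun, h ≠ 0 → ∃ (k : ℤ) (η : ℝ), 0 < η ∧ ∀ u ∈ Icc 0 η,
        edgeVal h e (t₀ + σ * u) = edgeVal h e t₀ + k * u) → m = 0 := by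
    intro t₀ δ σ m hδ h1 h2
    -- A root of order `|m| + 1` makes `m` a multiple of `|m| + 1`, which is possible only for `m =
    -- 0`.
    obtain ⟨h, hh⟩ := hdiv (m.natAbs + 1) (by omega)
    have hne : h ≠ 0 := ne_zero_of_pow_ne_zero (n := m.natAbs + 1) (by omega) (hh ▸ hf)
    obtain ⟨k, η, hη, h3⟩ := h2 h hne
    have h4 : ∀ t, edgeVal f e t = ((m.natAbs + 1 : ℕ) : ℝ) * edgeVal h e t := fun t => by
      rw [← (edgeVal_pow hne e t (m.natAbs + 1)).2, hh]
    have hmin : 0 < min δ η := lt_min hδ hη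
    have h5 := h1 (min δ η) ⟨hmin.le, min_le_left _ _⟩
    rw [h4, h4, h3 (min δ η) ⟨hmin.le, min_le_right _ _⟩] at h5
    have h6 : (((m.natAbs + 1 : ℕ) : ℝ) * k - m) * min δ η = 0 := by linarith
    have h7 : ((m.natAbs + 1 : ℕ) : ℝ) * k - m = 0 :=
      (mul_eq_zero.1 h6).resolve_right hmin.ne'
    have h8 : ((m.natAbs + 1 : ℕ) : ℤ) * k = m := by
      have : (((m.natAbs + 1 : ℕ) : ℤ) : ℝ) * k = m := by rw [Int.cast_natCast]; linarith
      exact_mod_cast this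
    by_contra hm
    have h9 : m.natAbs + 1 ∣ m.natAbs := by
      have h10 : ((m.natAbs + 1 : ℕ) : ℤ) ∣ m := ⟨k, h8.symm⟩
      exact Int.natCast_dvd.1 h10
    have := Nat.le_of_dvd (Int.natAbs_pos.2 hm) h9
    omega
  have hloc : IsLocallyConstant (edgeVal f e) := by
    refine (IsLocallyConstant.iff_eventually_eq _).2 fun t₀ => ?_
    obtain ⟨m, n, δ, hδ, h1, h2⟩ := exists_slopes hf e t₀
    have hm : m = 0 := by
      refine key t₀ δ 1 m hδ (fun u hu => ?_) fun h hh => ?_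
      · rw [h1 _ ⟨by linarith [hu.1], by linarith [hu.2]⟩]
        ring
      · obtain ⟨k, -, η, hη, h3, -⟩ := exists_slopes hh e t₀
        refine ⟨k, η, hη, fun u hu => ?_⟩
        rw [h3 _ ⟨by linarith [hu.1], by linarith [hu.2]⟩]
        ring
    have hn : n = 0 := by
      refine key t₀ δ (-1) n hδ (fun u hu => ?_) fun h hh => ?_
      · rw [h2 _ ⟨by linarith [hu.2], by linarith [hu.1]⟩]
        ring
      · obtain ⟨-, k, η, hη, -, h3⟩ := exists_slopes hh e t₀
        refine ⟨k, η, hη, fun u hu => ?_⟩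
        rw [h3 _ ⟨by linarith [hu.2], by linarith [hu.1]⟩]
        ring
    filter_upwards [Icc_mem_nhds (sub_lt_self t₀ hδ) (lt_add_of_pos_right t₀ hδ)] with t ht
    rcases le_total t₀ t with h3 | h3
    · rw [h1 t ⟨h3, ht.2⟩, hm]
      simp
    · rw [h2 t ⟨ht.1, h3⟩, hn]
      simp
  exact hloc.apply_eq_of_isPreconnected isPreconnected_univ (mem_univ _) (mem_univ _)

lemma rpt_natCast_tendsto {e : Γ.E} (h : Γ.len e = ⊤) :
    Tendsto (fun n : ℕ => Γ.rpt e n) atTop (𝓝 (Γ.pt e (Γ.terminus e))) := by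
  refine ((continuous_pt e).tendsto _).comp ?_
  rw [tendsto_subtype_rng]
  simpa [clamp, terminus, h] using ENNReal.tendsto_nat_nhds_top

/-- A nonzero rational function that has roots of all orders is constant. -/
lemma exists_eq_const_of_divisible {f : Γ.RatFun} (hf : f ≠ 0)
    (hdiv : ∀ n : ℕ, n ≠ 0 → ∃ h : Γ.RatFun, h ^ n = f) : ∃ c, f = const Γ c := by
  have h1 : ∀ e (t : Icc (0 : ℝ≥0∞) (Γ.len e)), f (Γ.pt e t) = f (Γ.rpt e 0) := by
    intro e t
    have h2 : ∀ t, f (Γ.rpt e t) = f (Γ.rpt e 0) := fun t => by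
      rw [← coe_edgeVal hf, ← coe_edgeVal hf, edgeVal_eq_of_divisible hf hdiv]
    by_cases ht : (t : ℝ≥0∞) = ⊤
    · have hlen : Γ.len e = ⊤ := top_le_iff.1 (ht ▸ t.2.2)
      have h3 : t = Γ.terminus e := Subtype.ext (by simp [ht, terminus, hlen])
      have h4 := (f.continuous.tendsto _).comp (rpt_natCast_tendsto hlen)
      rw [h3]
      refine tendsto_nhds_unique h4 ?_
      simp only [Function.comp_def, h2]
      exact tendsto_const_nhds
    · rw [← clamp_toReal t (lt_top_iff_ne_top.2 ht)]
      exact h2 _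
  have h2 : ∀ v w : Γ.V, f (Quot.mk _ (Sum.inl v)) = f (Quot.mk _ (Sum.inl w)) := by
    intro v w
    induction Γ.connected v w with
    | rel a b h =>
      obtain ⟨e, rfl, rfl⟩ := h
      have := (h1 e (Γ.origin e)).trans (h1 e (Γ.terminus e)).symm
      rwa [pt_src, pt_tgt] at this
    | refl => rfl
    | symm _ _ _ ih => exact ih.symm
    | trans _ _ _ _ _ ih ih' => exact ih.trans ih'
  have h3 : ∀ x, f x = f (Quot.mk _ (Sum.inl Γ.nonempty_V.some)) := by
    intro x
    induction x using Quot.ind with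
    | mk p =>
      rcases p with v | ⟨e, t⟩
      · exact h2 _ _
      · have := (h1 e t).trans (h1 e (Γ.origin e)).symm
        rw [pt_src] at this
        exact this.trans (h2 _ _)
  obtain ⟨x, hx⟩ := exists_finite Γ
  refine ⟨(f x).toReal, DFunLike.coe_injective (funext fun y => ?_)⟩
  rw [const_apply, coe_toReal hf hx, h3 y, h3 x]

end RatFun

end EdgeWeightedGraph

/-! ### Constants and evaluations under a semiring isomorphism. -/

/-- A monotone additive map of the reals is linear. -/
lemma AddMonoidHom.eq_mul_of_monotone (ρ : ℝ →+ ℝ) (h : Monotone ρ) (h1 : 0 < ρ 1) (x : ℝ) :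
    ρ x = ρ 1 * x := by
  have hq : ∀ q : ℚ, ρ q = ρ 1 * q := fun q => by
    have := map_rat_smul ρ q (1 : ℝ)
    rw [Rat.smul_def, Rat.smul_def, mul_one] at this
    rw [this, mul_comm]
  rcases lt_trichotomy (ρ x) (ρ 1 * x) with h2 | h2 | h2
  · obtain ⟨q, h3, h4⟩ := exists_rat_btwn ((div_lt_iff₀' h1).2 h2)
    have h5 := h h4.le
    rw [hq] at h5
    exact absurd ((div_lt_iff₀' h1).1 h3) h5.not_gt
  · exact h2
  · obtain ⟨q, h3, h4⟩ := exists_rat_btwn ((lt_div_iff₀' h1).2 h2)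
    have h5 := h h3.le
    rw [hq] at h5
    exact absurd ((lt_div_iff₀' h1).1 h4) h5.not_gt

namespace EdgeWeightedGraph

variable {Γ : EdgeWeightedGraph.{u}} {Γ₁ : EdgeWeightedGraph.{u}} {Γ₂ : EdgeWeightedGraph.{v}}

open RatFun

/-- A semiring isomorphism rescales the constants. -/
lemma exists_scale (ψ : Γ₁.RatFun ≃+* Γ₂.RatFun) :
    ∃ r : ℝ, 0 < r ∧ ∀ c, ψ (const Γ₁ c) = const Γ₂ (r * c) := by
  -- Having roots of every order is preserved by `ψ`, and `c / n` provides them for a constant `c`.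
  have h1 : ∀ c, ∃ d, ψ (const Γ₁ c) = const Γ₂ d := by
    intro c
    refine exists_eq_const_of_divisible ?_ fun n hn => ⟨ψ (const Γ₁ (c / n)), ?_⟩
    · rw [Ne, map_eq_zero_iff ψ ψ.injective]
      exact const_ne_zero c
    · rw [← map_pow, const_pow]
      congr 2
      field_simp
  choose ρ hρ using h1
  have hadd : ∀ a b, ρ (a + b) = ρ a + ρ b := fun a b => const_injective (Γ := Γ₂) (by
    rw [← const_mul_const, ← hρ, ← hρ, ← hρ, ← map_mul, const_mul_const])
  have hmax : ∀ a b, ρ (max a b) = max (ρ a) (ρ b) := fun a b => const_injective (Γ := Γ₂) (by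
    rw [← const_add_const, ← hρ, ← hρ, ← hρ, ← map_add, const_add_const])
  have hmono : Monotone ρ := fun a b hab => by
    have := hmax a b
    rw [max_eq_right hab] at this
    exact this ▸ le_max_left _ _
  have hinj : Function.Injective ρ := fun a b hab =>
    const_injective (ψ.injective (by rw [hρ, hρ, hab]))
  let ρ' : ℝ →+ ℝ := AddMonoidHom.mk' ρ hadd
  have h0 : ρ 0 = 0 := ρ'.map_zero
  have hpos : 0 < ρ 1 := lt_of_le_of_ne (h0 ▸ hmono zero_le_one)
    fun h => zero_ne_one (hinj (h0.trans h))
  exact ⟨ρ 1, hpos, fun c => by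
    rw [hρ]
    exact congrArg _ (ρ'.eq_mul_of_monotone hmono hpos c)⟩

lemma scale_symm {ψ : Γ₁.RatFun ≃+* Γ₂.RatFun} {r : ℝ} (hr : 0 < r)
    (hψ : ∀ c, ψ (const Γ₁ c) = const Γ₂ (r * c)) (c : ℝ) :
    ψ.symm (const Γ₂ c) = const Γ₁ (r⁻¹ * c) := by
  rw [RingEquiv.symm_apply_eq, hψ]
  congr 1
  field_simp

/-- The evaluation of `ψ f` at a point of `Γ₂` is the rescaled evaluation of `f` at some point
of `Γ₁`. -/
lemma exists_eval_eq {ψ : Γ₁.RatFun ≃+* Γ₂.RatFun} {r : ℝ} (hr : 0 < r)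
    (hψ : ∀ c, ψ (const Γ₁ c) = const Γ₂ (r * c)) (y : Γ₂.Pt) :
    ∃ x : Γ₁.Pt, ∀ f : Γ₁.RatFun, ψ f y = r * f x := by
  by_contra! hc
  have hr' : (0 : EReal) < r := by exact_mod_cast hr
  have h1 : ∀ x : Γ₁.Pt, ∃ f : Γ₁.RatFun, ψ f y < r * f x := by
    intro x
    obtain ⟨f, hf⟩ := hc x
    rcases lt_or_gt_of_ne hf with h | h
    · exact ⟨f, h⟩
    -- When the inequality points the wrong way, the inverse of `f` reverses it; `f = 0` is excluded
    -- because both sides would be `-∞`.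
    have hf0 : f ≠ 0 := by
      rintro rfl
      rw [map_zero] at hf
      exact hf (by simp only [zero_apply, EReal.coe_mul_bot_of_pos hr])
    obtain ⟨g, -, hg1, hg2⟩ := exists_inverse hf0
    have hg3 : ψ f * ψ g = 1 := by rw [← map_mul, hg1, map_one]
    refine ⟨g, ?_⟩
    rw [eq_neg_of_mul_eq_one hg3, hg2, mul_neg]
    exact EReal.neg_lt_neg_iff.2 h
  have h2 : ∃ h : Γ₁.RatFun, ψ h y < 0 ∧ ∀ z ∈ (univ : Set Γ₁.Pt), 0 ≤ h z := by
    refine isCompact_univ.induction_on (p := fun S : Set Γ₁.Pt => ∃ h : Γ₁.RatFun, ψ h y < 0 ∧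
      ∀ z ∈ S, 0 ≤ h z) ?_ ?_ ?_ ?_
    · exact ⟨0, by rw [map_zero]; exact EReal.bot_lt_zero, by simp⟩
    · rintro S T hST ⟨h, h3, h4⟩
      exact ⟨h, h3, fun z hz => h4 z (hST hz)⟩
    · rintro S T ⟨h, h3, h4⟩ ⟨h', h3', h4'⟩
      refine ⟨h + h', ?_, ?_⟩
      · rw [map_add, RatFun.add_apply]
        exact max_lt h3 h3'
      · rintro z (hz | hz)
        · exact le_max_of_le_left (h4 z hz)
        · exact le_max_of_le_right (h4' z hz)
    · intro x _
      obtain ⟨f, hf⟩ := h1 x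
      -- Shifting `f` by `-c / r` moves the gap to zero: the value of the image at `y` becomes
      -- negative, while the function is nonnegative near `x`.
      obtain ⟨c, hc1, hc2⟩ := EReal.lt_iff_exists_real_btwn.1 hf
      have hrc : (c : EReal) = r * ((r⁻¹ * c : ℝ) : EReal) := by
        rw [← EReal.coe_mul]
        congr 1
        field_simp
      have hfx : ((r⁻¹ * c : ℝ) : EReal) < f x := by
        by_contra! h3
        have := mul_le_mul_of_nonneg_left h3 hr'.le
        rw [← hrc] at this
        exact this.not_gt hc2
      refine ⟨{z | ((r⁻¹ * c : ℝ) : EReal) < f z},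
        mem_nhdsWithin_of_mem_nhds ((isOpen_lt continuous_const f.continuous).mem_nhds hfx),
        const Γ₁ (-(r⁻¹ * c)) * f, ?_, fun z hz => ?_⟩
      · rw [map_mul, hψ, const_mul_apply]
        have h3 : r * -(r⁻¹ * c) = -c := by field_simp
        rw [h3, EReal.coe_neg, add_comm, ← sub_eq_add_neg]
        exact (EReal.sub_neg (Or.inr (EReal.coe_ne_top _)) (Or.inr (EReal.coe_ne_bot _))).2 hc1
      · rw [const_mul_apply, EReal.coe_neg, add_comm, ← sub_eq_add_neg]
        exact (EReal.sub_nonneg (Or.inr (EReal.coe_ne_top _)) (Or.inr (EReal.coe_ne_bot _))).2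
          (le_of_lt hz)
  obtain ⟨h, h3, h4⟩ := h2
  -- The unit is the constant `0`, so nonnegativity is an algebraic identity and passes to `ψ h`.
  have h5 : h + 1 = h := DFunLike.coe_injective (funext fun z => by
    rw [RatFun.add_apply, RatFun.one_apply]
    exact max_eq_left (h4 z (mem_univ z)))
  have h6 : ψ h + 1 = ψ h := by rw [← map_one ψ, ← map_add, h5]
  have h7 : max (ψ h y) 0 = ψ h y := DFunLike.congr_fun h6 y
  exact (max_eq_left_iff.1 h7).not_gt h3

end EdgeWeightedGraph

namespace EdgeWeightedGraph

variable {Γ : EdgeWeightedGraph.{u}}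

open RatFun

/-! Chip-firing moves at points at infinity. -/

lemma chipFiring_top_eq (A : Set Γ.Pt) (x : Γ.Pt) :
    chipFiring A ⊤ x = -((⨅ a ∈ A, pdist x a : ℝ≥0∞) : EReal) := by
  rw [chipFiring, min_eq_right le_top]

lemma tail_eq_endNhd {e : Γ.E} (h : Γ.len e = ⊤) {s : Icc (0 : ℝ≥0∞) (Γ.len e)}
    (hs : (s : ℝ≥0∞) < ⊤) : Γ.tail e s = endNhd h hs := by
  ext x
  constructor
  · rintro ⟨t, ht, rfl⟩
    exact ⟨rfl, ht⟩
  · intro hx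
    obtain ⟨t, ht, rfl⟩ := exists_of_mem_endNhd h hs hx
    exact ⟨t, ht, rfl⟩

lemma pt_mem_tail {e : Γ.E} (h : Γ.len e = ⊤) {s : Icc (0 : ℝ≥0∞) (Γ.len e)}
    (hs : (s : ℝ≥0∞) < ⊤) {e' : Γ.E} {t : Icc (0 : ℝ≥0∞) (Γ.len e')} :
    Γ.pt e' t ∈ Γ.tail e s ↔ e' = e ∧ (s : ℝ≥0∞) < t := by
  rw [tail_eq_endNhd h hs]
  rfl

lemma pt_injective_of_top {e : Γ.E} (h : Γ.len e = ⊤) : Function.Injective (Γ.pt e) := by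
  have key : ∀ s t : Icc (0 : ℝ≥0∞) (Γ.len e), Γ.pt e s = Γ.pt e t → ¬ s < t := by
    intro s t hst hlt
    have hs : (s : ℝ≥0∞) < ⊤ := lt_of_lt_of_le hlt le_top
    have h1 : Γ.pt e t ∈ Γ.tail e s := ⟨t, hlt, rfl⟩
    rw [← hst, pt_mem_tail h hs] at h1
    exact lt_irrefl _ h1.2
  intro s t hst
  exact le_antisymm (not_lt.1 (key t s hst.symm)) (not_lt.1 (key s t hst))

/-- A chain that starts in the tail can leave it only along `e`, past the coordinate `s`. While the
current point is in the tail, the next move is on `e`, so each move lowers the excess over `s` by at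
most its length. -/
lemma ChainLength.tsub_le_of_notMem_tail {e : Γ.E} (h : Γ.len e = ⊤)
    {s : Icc (0 : ℝ≥0∞) (Γ.len e)} (hs : (s : ℝ≥0∞) < ⊤) {y a : Γ.Pt} {L : ℝ≥0∞}
    (hL : ChainLength y a L) (ha : a ∉ Γ.tail e s) (t : Icc (0 : ℝ≥0∞) (Γ.len e))
    (hy : y = Γ.pt e t) : (t : ℝ≥0∞) - s ≤ L := by
  induction hL generalizing t with
  | refl =>
    rw [hy, pt_mem_tail h hs] at ha
    simp only [true_and, not_lt] at ha
    rw [tsub_eq_zero_of_le ha]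
  | step e₁ s₁ t₁ a L _ ih =>
    rcases le_or_gt (t : ℝ≥0∞) s with h1 | h1
    · rw [tsub_eq_zero_of_le h1]
      exact zero_le
    have h2 : Γ.pt e₁ s₁ ∈ Γ.tail e s := hy ▸ ⟨t, h1, rfl⟩
    obtain ⟨rfl, -⟩ := (pt_mem_tail h hs).1 h2
    obtain rfl := pt_injective_of_top h hy
    exact (tsub_le_tsub_add_tsub (b := (t₁ : ℝ≥0∞))).trans
      (add_le_add le_self_add (ih ha t₁ rfl))

lemma iInf_pdist_compl_tail {e : Γ.E} (h : Γ.len e = ⊤) {s : Icc (0 : ℝ≥0∞) (Γ.len e)}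
    (hs : (s : ℝ≥0∞) < ⊤) (t : Icc (0 : ℝ≥0∞) (Γ.len e)) :
    ⨅ a ∈ (Γ.tail e s)ᶜ, pdist (Γ.pt e t) a = (t : ℝ≥0∞) - s := by
  apply le_antisymm
  · rcases le_total (t : ℝ≥0∞) s with h1 | h1
    · refine (iInf₂_le (Γ.pt e t) ?_).trans (by simp)
      rw [mem_compl_iff, pt_mem_tail h hs]
      simpa using h1
    · refine (iInf₂_le (Γ.pt e s) ?_).trans ((pdist_pt_le _ _ _).trans ?_)
      · rw [mem_compl_iff, pt_mem_tail h hs]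
        simp
      · rw [tsub_eq_zero_of_le h1, add_zero]
  · refine le_iInf₂ fun a ha => le_sInf fun L hL => ?_
    exact ChainLength.tsub_le_of_notMem_tail h hs hL ha t rfl

lemma chipFiring_compl_of_notMem {A : Set Γ.Pt} {x : Γ.Pt} (hx : x ∉ A) :
    chipFiring Aᶜ ⊤ x = 0 := by
  have h1 : ⨅ a ∈ Aᶜ, pdist x a = 0 := nonpos_iff_eq_zero.1 ((iInf₂_le x hx).trans (by simp))
  rw [chipFiring_top_eq, h1]
  simp

lemma chipFiring_compl_tail {e : Γ.E} (h : Γ.len e = ⊤) {s : Icc (0 : ℝ≥0∞) (Γ.len e)}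
    (hs : (s : ℝ≥0∞) < ⊤) (t : Icc (0 : ℝ≥0∞) (Γ.len e)) :
    chipFiring (Γ.tail e s)ᶜ ⊤ (Γ.pt e t) = -(((t : ℝ≥0∞) - s : ℝ≥0∞) : EReal) := by
  rw [chipFiring_top_eq, iInf_pdist_compl_tail h hs]

lemma isRational_chipFiring_compl_tail {e : Γ.E} (h : Γ.len e = ⊤)
    {s : Icc (0 : ℝ≥0∞) (Γ.len e)} (hs : (s : ℝ≥0∞) < ⊤) :
    IsRational (chipFiring (Γ.tail e s)ᶜ ⊤) := by
  have h0 : ∀ e', e' ≠ e → ∀ t, chipFiring (Γ.tail e s)ᶜ ⊤ (Γ.pt e' t) = 0 := fun e' he t =>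
    chipFiring_compl_of_notMem fun h1 => he ((pt_mem_tail h hs).1 h1).1
  refine ⟨continuous_of_edges fun e' => ?_, Or.inr ⟨fun x hx => ?_, fun e' => ?_⟩⟩
  · by_cases he : e' = e
    · subst he
      simp only [chipFiring_compl_tail h hs]
      have h1 : Continuous fun t : Icc (0 : ℝ≥0∞) (Γ.len e') => ((t : ℝ≥0∞) - s : ℝ≥0∞) :=
        (ENNReal.continuous_sub_right _).comp continuous_subtype_val
      exact (continuous_coe_ennreal_ereal.comp h1).neg
    · simp only [h0 e' he]
      exact continuous_const
  · by_cases h1 : x ∈ Γ.tail e s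
    · obtain ⟨t, -, rfl⟩ := h1
      have ht := coe_lt_top_of_not_isInfinite hx
      rw [chipFiring_compl_tail h hs]
      have h2 : (t : ℝ≥0∞) - s ≠ ⊤ := (tsub_le_self.trans_lt ht).ne
      lift (t : ℝ≥0∞) - s to NNReal using h2 with d
      constructor
      · rw [Ne, EReal.neg_eq_bot_iff]
        exact mt EReal.coe_ennreal_eq_top_iff.1 ENNReal.coe_ne_top
      · rw [Ne, EReal.neg_eq_top_iff]
        exact EReal.coe_ennreal_ne_bot _
    · rw [chipFiring_compl_of_notMem h1]
      exact ⟨EReal.zero_ne_bot, EReal.zero_ne_top⟩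
  · by_cases he : e' = e
    · subst he
      refine ⟨{(s : ℝ≥0∞)}, fun a b hab => ?_⟩
      have h1 := hab s (by simp)
      by_cases h2 : b ≤ s
      · refine ⟨0, 0, fun t _ ht => ?_⟩
        rw [chipFiring_compl_tail h hs, tsub_eq_zero_of_le (ht.le.trans h2)]
        simp
      · have h3 : (s : ℝ≥0∞) ≤ a := not_lt.1 fun h3 => h1 ⟨h3, not_le.1 h2⟩
        refine ⟨-1, (s : ℝ≥0∞).toReal, fun t ht ht' => ?_⟩
        have h4 : (t : ℝ≥0∞) < ⊤ := ht'.trans_le le_top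
        have h5 : ((t : ℝ≥0∞) - s : ℝ≥0∞) ≠ ⊤ := (tsub_le_self.trans_lt h4).ne
        rw [chipFiring_compl_tail h hs, ← EReal.coe_ennreal_toReal h5,
          ENNReal.toReal_sub_of_le (h3.trans ht.le) h4.ne, ← EReal.coe_neg]
        congr 1
        push_cast
        ring
    · exact ⟨∅, fun a b _ => ⟨0, 0, fun t _ _ => by rw [h0 e' he]; simp⟩⟩

/-- Some tail of `e` with finite starting coordinate avoids `y`: start it at `y` itself, or at the
origin if `y` is not on `e`. Any chain from `x` must cross the whole tail, of length `⊤`. -/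
lemma pdist_eq_top_of_isInfinite {x y : Γ.Pt} (hx : IsInfinite x) (hxy : y ≠ x) :
    pdist x y = ⊤ := by
  obtain ⟨e, h, rfl⟩ := hx
  by_cases hy : ∃ t, y = Γ.pt e t
  · obtain ⟨t, rfl⟩ := hy
    have ht : (t : ℝ≥0∞) < ⊤ := lt_top_iff_ne_top.2 fun h1 => hxy (congrArg _
      (Subtype.ext (by simp [h1, terminus, h])))
    refine top_le_iff.1 (le_trans (le_of_eq ?_) (le_sInf fun L hL =>
      ChainLength.tsub_le_of_notMem_tail h ht hL (a := Γ.pt e t) ?_ (Γ.terminus e) rfl))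
    · simp [terminus, h, ENNReal.top_sub ht.ne]
    · rw [pt_mem_tail h ht]
      simp
  · push Not at hy
    refine top_le_iff.1 (le_trans (le_of_eq ?_) (le_sInf fun L hL =>
      ChainLength.tsub_le_of_notMem_tail h (s := Γ.origin e) (by simp [origin]) hL (a := y) ?_
        (Γ.terminus e) rfl))
    · simp [terminus, origin, h]
    · rintro ⟨t, -, rfl⟩
      exact hy t rfl

end EdgeWeightedGraph

/-! ### Chip-firing moves at finite points and separation of points. -/

namespace EdgeWeightedGraph

variable {Γ : EdgeWeightedGraph.{u}}

open RatFun

/-- The distance of two coordinates. -/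
noncomputable def ndist (s t : ℝ≥0∞) : ℝ≥0∞ := (s - t) + (t - s)

@[simp] lemma ndist_self (s : ℝ≥0∞) : ndist s s = 0 := by simp [ndist]

lemma ndist_comm (s t : ℝ≥0∞) : ndist s t = ndist t s := add_comm _ _

lemma ndist_of_le {s t : ℝ≥0∞} (h : s ≤ t) : ndist s t = t - s := by
  rw [ndist, tsub_eq_zero_of_le h, zero_add]

lemma ndist_triangle (s t u : ℝ≥0∞) : ndist s u ≤ ndist s t + ndist t u := by
  unfold ndist
  calc (s - u) + (u - s) ≤ ((s - t) + (t - u)) + ((u - t) + (t - s)) :=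
        add_le_add tsub_le_tsub_add_tsub tsub_le_tsub_add_tsub
    _ = _ := by ring

lemma pdist_pt_le_ndist (e : Γ.E) (s t : Icc (0 : ℝ≥0∞) (Γ.len e)) :
    pdist (Γ.pt e s) (Γ.pt e t) ≤ ndist s t := pdist_pt_le e s t

/-- The number `ε` is at most half the distance of `x` to the vertices other than `x` on the
edges at `x`. -/
def IsGap (x : Γ.Pt) (ε : ℝ≥0∞) : Prop := ∀ e (s : Icc (0 : ℝ≥0∞) (Γ.len e)), Γ.pt e s = x →
  ((s : ℝ≥0∞) = 0 ∨ 2 * ε ≤ s) ∧ ((s : ℝ≥0∞) = Γ.len e ∨ s + 2 * ε ≤ Γ.len e)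

/-- Different coordinates of one point on the same edge can only be the two ends, as on a loop. -/
lemma finite_coordinates (x : Γ.Pt) (e : Γ.E) :
    {s : Icc (0 : ℝ≥0∞) (Γ.len e) | Γ.pt e s = x}.Finite := by
  by_cases h : {s : Icc (0 : ℝ≥0∞) (Γ.len e) | Γ.pt e s = x}.Subsingleton
  · exact h.finite
  refine (Set.toFinite {Γ.origin e, Γ.terminus e}).subset fun s hs => ?_
  obtain ⟨a, ha, hsa⟩ : ∃ a, Γ.pt e a = x ∧ s ≠ a := by
    by_contra! h1
    exact h fun a ha b hb => (h1 a ha).symm.trans (h1 b hb)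
  rcases (eq_or_end_of_pt_eq_same (hs.trans ha.symm)).resolve_left hsa with ⟨h1 | h1, -⟩
  · exact Or.inl (Subtype.ext h1)
  · exact Or.inr (Subtype.ext h1)

lemma exists_isGap (x : Γ.Pt) :
    ∃ ε : ℝ, 0 < ε ∧ IsGap x (ENNReal.ofReal ε) := by
  have := Γ.finite_E
  have hlim : Tendsto (fun ε : ℝ => 2 * ENNReal.ofReal ε) (𝓝[>] 0) (𝓝 0) := by
    have h1 : Tendsto (fun ε : ℝ => 2 * ENNReal.ofReal ε) (𝓝 0) (𝓝 (2 * ENNReal.ofReal 0)) :=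
      ENNReal.Tendsto.const_mul (ENNReal.continuous_ofReal.tendsto 0) (Or.inr (by simp))
    simp only [ENNReal.ofReal_zero, mul_zero] at h1
    exact h1.mono_left nhdsWithin_le_nhds
  have h1 : ∀ᶠ ε : ℝ in 𝓝[>] 0, ∀ e, ∀ s ∈ {s : Icc (0 : ℝ≥0∞) (Γ.len e) | Γ.pt e s = x},
      ((s : ℝ≥0∞) = 0 ∨ 2 * ENNReal.ofReal ε ≤ s) ∧
        ((s : ℝ≥0∞) = Γ.len e ∨ s + 2 * ENNReal.ofReal ε ≤ Γ.len e) := by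
    refine eventually_all.2 fun e => (eventually_all_finite (finite_coordinates x e)).2
      fun s hs => Eventually.and ?_ ?_
    · by_cases h : (s : ℝ≥0∞) = 0
      · exact Eventually.of_forall fun _ => Or.inl h
      · filter_upwards [hlim.eventually_le_const (pos_iff_ne_zero.2 h)] with ε hε
        exact Or.inr hε
    · by_cases h : (s : ℝ≥0∞) = Γ.len e
      · exact Eventually.of_forall fun _ => Or.inl h
      · have hlt : (s : ℝ≥0∞) < Γ.len e := lt_of_le_of_ne s.2.2 h
        filter_upwards [hlim.eventually_le_const (tsub_pos_of_lt hlt)] with ε hε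
        right
        calc (s : ℝ≥0∞) + 2 * ENNReal.ofReal ε ≤ s + (Γ.len e - s) := by gcongr
          _ = Γ.len e := add_tsub_cancel_of_le s.2.2
  obtain ⟨ε, hε, h2⟩ := (h1.and self_mem_nhdsWithin).exists
  exact ⟨ε, h2, fun e s hs => hε e s hs⟩

/-- A chain changes edges only at an end of an edge. By the gap condition, an end closer than `ε` to
a coordinate of `x` is that coordinate, so a chain to `x` shorter than `ε` changes edges only at
`x`. Its length thus bounds a coordinate distance on the edge where it starts. -/
lemma ChainLength.exists_ndist_le {x y : Γ.Pt} (hx : ¬ IsInfinite x) {ε L : ℝ≥0∞}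
    (hε : IsGap x ε) (hL : ChainLength y x L) (e : Γ.E) (t : Icc (0 : ℝ≥0∞) (Γ.len e))
    (hy : y = Γ.pt e t) : ε ≤ L ∨ ∃ s, Γ.pt e s = x ∧ ndist t s ≤ L := by
  induction hL generalizing e t with
  | refl => exact Or.inr ⟨t, hy.symm, by simp⟩
  | step e₁ s₁ t₁ x L _ ih =>
    change ε ≤ ndist s₁ t₁ + L ∨ ∃ s, _ ∧ _ ≤ ndist s₁ t₁ + L
    rcases ih hx hε e₁ t₁ rfl with h1 | ⟨s', hs', h1⟩
    · exact Or.inl (h1.trans le_add_self)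
    have h2 : ndist s₁ s' ≤ ndist s₁ t₁ + L :=
      (ndist_triangle _ t₁ _).trans (add_le_add le_rfl h1)
    rcases eq_or_end_of_pt_eq hy.symm with h3 | h3
    · obtain ⟨rfl, h3⟩ := Sigma.mk.inj_iff.1 h3
      obtain rfl := eq_of_heq h3
      exact Or.inr ⟨s', hs', h2⟩
    by_cases h4 : ε ≤ ndist s₁ s'
    · exact Or.inl (h4.trans h2)
    have h5 : s' = s₁ := by
      have h6 := hε e₁ s' hs'
      have h7 : (s' : ℝ≥0∞) < ⊤ := coe_lt_top_of_not_isInfinite (by rw [hs']; exact hx)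
      have hle : ε ≤ 2 * ε := by rw [two_mul]; exact le_self_add
      refine Subtype.ext ?_
      rcases h3 with h3 | h3
      · rw [h3, ndist_of_le zero_le, tsub_zero] at h4
        rw [h3]
        exact h6.1.resolve_right fun h8 => h4 (hle.trans h8)
      · rw [ndist_comm, ndist_of_le (s'.2.2.trans_eq h3.symm), h3] at h4
        rw [h3]
        refine h6.2.resolve_right fun h8 => h4 (hle.trans ?_)
        exact ENNReal.le_sub_of_add_le_left h7.ne h8
    subst h5
    exact Or.inr ⟨t, hy ▸ hs', by simp⟩

lemma le_pdist_of_forall {x : Γ.Pt} (hx : ¬ IsInfinite x) {ε c : ℝ≥0∞} (hε : IsGap x ε)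
    (hc : c ≤ ε) {e : Γ.E} {t : Icc (0 : ℝ≥0∞) (Γ.len e)}
    (h : ∀ s : Icc (0 : ℝ≥0∞) (Γ.len e), Γ.pt e s = x → c ≤ ndist t s) :
    c ≤ pdist (Γ.pt e t) x := by
  refine le_sInf fun L hL => ?_
  rcases ChainLength.exists_ndist_le hx hε hL e t rfl with h1 | ⟨s, h1, h2⟩
  exacts [hc.trans h1, (h s h1).trans h2]

lemma IsGap.le_ndist {x : Γ.Pt} {ε : ℝ≥0∞} (hε : IsGap x ε) {e : Γ.E}
    {s s' : Icc (0 : ℝ≥0∞) (Γ.len e)} (hs : Γ.pt e s = x) (hs' : Γ.pt e s' = x) (hne : s ≠ s') :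
    2 * ε ≤ ndist s s' := by
  have h1 := hε e s hs
  have h2 := hε e s' hs'
  obtain ⟨h3, h4⟩ := (eq_or_end_of_pt_eq_same (hs.trans hs'.symm)).resolve_left hne
  rcases h3 with h3 | h3
  · have h5 : (s' : ℝ≥0∞) ≠ 0 := fun h5 => hne (Subtype.ext (h3.trans h5.symm))
    rw [h3, ndist_of_le zero_le, tsub_zero]
    exact h2.1.resolve_left h5
  · have h5 : (s' : ℝ≥0∞) ≠ Γ.len e := fun h5 => hne (Subtype.ext (h3.trans h5.symm))
    have h6 := h4.resolve_right h5
    rw [h6, ndist_comm, ndist_of_le zero_le, tsub_zero]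
    refine h1.1.resolve_left fun h7 => h5 ?_
    rw [h6, ← h3, h7]

lemma chipFiring_singleton (x y : Γ.Pt) (l : ℝ≥0∞) :
    chipFiring {x} l y = -((min l (pdist y x) : ℝ≥0∞) : EReal) := by
  simp [chipFiring]

/-- Truncated at the gap, the path distance is a finite minimum of coordinate distances (with empty
minimum `⊤`), which makes its continuity and positivity evident. -/
lemma min_pdist_eq {x : Γ.Pt} (hx : ¬ IsInfinite x) {ε : ℝ≥0∞} (hε : IsGap x ε) (e : Γ.E)
    (t : Icc (0 : ℝ≥0∞) (Γ.len e)) :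
    min ε (pdist (Γ.pt e t) x) =
      min ε ((finite_coordinates x e).toFinset.inf fun s => ndist t s) := by
  apply le_antisymm
  · refine le_min (min_le_left _ _) (Finset.le_inf fun s hs => ?_)
    have hs' : Γ.pt e s = x := (finite_coordinates x e).mem_toFinset.1 hs
    rw [← hs']
    exact (min_le_right _ _).trans (pdist_pt_le_ndist e t s)
  · refine le_min (min_le_left _ _) (le_pdist_of_forall hx hε (min_le_left _ _) fun s hs => ?_)
    exact (min_le_right _ _).trans (Finset.inf_le (by simpa using hs))

lemma continuous_ndist {s : ℝ≥0∞} (hs : s ≠ ⊤) : Continuous fun t => ndist t s := by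
  unfold ndist
  exact (ENNReal.continuous_sub_right s).add (ENNReal.continuous_sub_left hs)

lemma coe_neg_ennreal {a : ℝ≥0∞} (ha : a ≠ ⊤) : -(a : EReal) = ((-a.toReal : ℝ) : EReal) := by
  rw [EReal.coe_neg, EReal.coe_ennreal_toReal ha]

/-- The break points are the coordinates `s` of `x` and `s ± ε`. An interval avoiding them is either
everywhere at distance at least `ε`, with constant value `-ε`, or lies on one side of a single `s`
within distance `ε`, with slope `1` or `-1`. -/
lemma isPiecewiseAffine_chipFiring_singleton {x : Γ.Pt} (hx : ¬ IsInfinite x) {ε : ℝ≥0∞}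
    (hε : IsGap x ε) (hε' : ε ≠ ⊤) : IsPiecewiseAffine (chipFiring {x} ε) := by
  classical
  intro e
  let F : Finset ℝ≥0∞ := (finite_coordinates x e).toFinset.image Subtype.val
  have hF : ∀ s : Icc (0 : ℝ≥0∞) (Γ.len e), Γ.pt e s = x → (s : ℝ≥0∞) ∈ F := fun s hs =>
    Finset.mem_image_of_mem _ (by simpa using hs)
  refine ⟨F ∪ F.image (· + ε) ∪ F.image (· - ε), fun a b hab => ?_⟩
  have hb1 : ∀ s ∈ F, s ∉ Ioo a b := fun s hs => hab s (by simp [hs])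
  have hb2 : ∀ s ∈ F, s + ε ∉ Ioo a b := fun s hs => hab _ (Finset.mem_union_left _
    (Finset.mem_union_right _ (Finset.mem_image_of_mem _ hs)))
  have hb3 : ∀ s ∈ F, s - ε ∉ Ioo a b := fun s hs => hab _
    (Finset.mem_union_right _ (Finset.mem_image_of_mem _ hs))
  by_cases h : ∃ s : Icc (0 : ℝ≥0∞) (Γ.len e), Γ.pt e s = x ∧ ∃ t ∈ Ioo a b, ndist t s < ε
  · obtain ⟨s, hs, t₁, ht₁, h1⟩ := h
    have hst : (s : ℝ≥0∞) < ⊤ := coe_lt_top_of_not_isInfinite (hs ▸ hx)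
    have hnear : ∀ t : Icc (0 : ℝ≥0∞) (Γ.len e), ndist t s < ε →
        min ε (pdist (Γ.pt e t) x) = ndist t s := by
      intro t ht
      have hle : pdist (Γ.pt e t) x ≤ ndist t s := hs ▸ pdist_pt_le_ndist e t s
      rw [min_eq_right (hle.trans ht.le)]
      refine le_antisymm hle (le_pdist_of_forall hx hε ht.le fun s' hs' => ?_)
      by_cases hne : s = s'
      · rw [hne]
      by_contra! hlt
      -- Different coordinates of `x` are at least `2 * ε` apart, so they cannot both be within `ε`
      -- of `t`. This is what the factor two in `IsGap` is for.
      have h2 := (hε.le_ndist hs hs' hne).trans (ndist_triangle s t s')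
      rw [ndist_comm s t, two_mul] at h2
      exact absurd (ENNReal.add_lt_add ht (hlt.trans ht)) h2.not_gt
    rcases lt_trichotomy (s : ℝ≥0∞) t₁ with h2 | h2 | h2
    · rw [ndist_comm, ndist_of_le h2.le] at h1
      have h3 : (s : ℝ≥0∞) ≤ a := not_lt.1 fun h3 => hb1 s (hF s hs) ⟨h3, h2.trans ht₁.2⟩
      have h4 : t₁ < s + ε := by
        rw [add_comm]
        exact ENNReal.lt_add_of_sub_lt_right (Or.inr hst.ne) h1
      have h5 : b ≤ s + ε := not_lt.1 fun h5 => hb2 s (hF s hs) ⟨ht₁.1.trans h4, h5⟩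
      refine ⟨-1, (s : ℝ≥0∞).toReal, fun t ht ht' => ?_⟩
      have htt : (t : ℝ≥0∞) < ⊤ := ht'.trans_le le_top
      have h6 : (s : ℝ≥0∞) ≤ t := h3.trans ht.le
      have h7 : ndist t s = t - s := by rw [ndist_comm, ndist_of_le h6]
      have h8 : ndist t s < ε := by
        rw [h7]
        exact ENNReal.sub_lt_of_lt_add h6 (by rw [add_comm]; exact ht'.trans_le h5)
      rw [chipFiring_singleton, hnear t h8, coe_neg_ennreal (h8.trans_le le_top).ne, h7,
        ENNReal.toReal_sub_of_le h6 htt.ne]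
      congr 1
      push_cast
      ring
    · exact absurd ht₁ (h2 ▸ hb1 s (hF s hs))
    · rw [ndist_of_le h2.le] at h1
      have h3 : b ≤ s := not_lt.1 fun h3 => hb1 s (hF s hs) ⟨ht₁.1.trans h2, h3⟩
      have h4 : (s : ℝ≥0∞) - ε < t₁ := by
        rcases le_total (s : ℝ≥0∞) ε with h5 | h5
        · rw [tsub_eq_zero_of_le h5]
          exact zero_le.trans_lt ht₁.1
        refine ENNReal.sub_lt_of_lt_add h5 ?_
        rw [add_comm]
        exact ENNReal.lt_add_of_sub_lt_right (Or.inl hst.ne) h1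
      have h5 : (s : ℝ≥0∞) - ε ≤ a := not_lt.1 fun h5 => hb3 s (hF s hs) ⟨h5, h4.trans ht₁.2⟩
      refine ⟨1, -(s : ℝ≥0∞).toReal, fun t ht ht' => ?_⟩
      have h6 : (t : ℝ≥0∞) ≤ s := ht'.le.trans h3
      have h7 : ndist t s = s - t := ndist_of_le h6
      have h8 : ndist t s < ε := by
        rw [h7]
        refine ENNReal.sub_lt_of_lt_add h6 ?_
        have h9 : (s : ℝ≥0∞) - ε < t := h5.trans_lt ht
        rw [add_comm]
        exact ENNReal.lt_add_of_sub_lt_right (Or.inl hst.ne) h9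
      rw [chipFiring_singleton, hnear t h8, coe_neg_ennreal (h8.trans_le le_top).ne, h7,
        ENNReal.toReal_sub_of_le h6 hst.ne]
      congr 1
      push_cast
      ring
  · push Not at h
    refine ⟨0, -ε.toReal, fun t ht ht' => ?_⟩
    have h1 : ε ≤ pdist (Γ.pt e t) x :=
      le_pdist_of_forall hx hε le_rfl fun s hs => h s hs t ⟨ht, ht'⟩
    rw [chipFiring_singleton, min_eq_left h1, coe_neg_ennreal hε']
    simp

lemma isRational_chipFiring_singleton {x : Γ.Pt} (hx : ¬ IsInfinite x) {ε : ℝ≥0∞}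
    (hε : IsGap x ε) (hε' : ε ≠ ⊤) : IsRational (chipFiring {x} ε) := by
  refine ⟨continuous_of_edges fun e => ?_, Or.inr ⟨fun y _ => ?_,
    isPiecewiseAffine_chipFiring_singleton hx hε hε'⟩⟩
  · simp only [chipFiring_singleton, min_pdist_eq hx hε]
    refine (continuous_coe_ennreal_ereal.comp (continuous_const.min ?_)).neg
    have h1 : ∀ s ∈ (finite_coordinates x e).toFinset,
        Continuous fun t : Icc (0 : ℝ≥0∞) (Γ.len e) => ndist t s := fun s hs => by
      have hs' : Γ.pt e s = x := (finite_coordinates x e).mem_toFinset.1 hs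
      exact (continuous_ndist (coe_lt_top_of_not_isInfinite (hs' ▸ hx)).ne).comp
        continuous_subtype_val
    exact continuous_iff_continuousAt.2 fun t => ContinuousAt.finset_inf_apply fun s hs =>
      (h1 s hs).continuousAt
  · rw [chipFiring_singleton, coe_neg_ennreal (ne_top_of_le_ne_top hε' (min_le_left _ _))]
    exact ⟨EReal.coe_ne_bot _, EReal.coe_ne_top _⟩

/-- Distinct points have positive distance. -/
lemma pdist_pos {x y : Γ.Pt} (hxy : y ≠ x) : 0 < pdist y x := by
  by_cases hx : IsInfinite x
  · rw [pdist_comm, pdist_eq_top_of_isInfinite hx hxy]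
    exact ENNReal.zero_lt_top
  obtain ⟨ε, hε, h1⟩ := exists_isGap x
  by_contra! h2
  have h3 : pdist y x = 0 := nonpos_iff_eq_zero.1 h2
  have h4 : ∃ L, ChainLength y x L ∧ L < ENNReal.ofReal ε :=
    sInf_lt_iff.1 (lt_of_eq_of_lt h3 (ENNReal.ofReal_pos.2 hε))
  obtain ⟨L, hL, h5⟩ := h4
  by_cases hy : ∃ e t, y = Γ.pt e t
  swap
  -- A point on no edge is the start of the trivial chain only.
  · cases hL with
    | refl => exact hxy rfl
    | step e s t y L => exact hy ⟨e, s, rfl⟩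
  obtain ⟨e, t, rfl⟩ := hy
  have h6 : ∀ s : Icc (0 : ℝ≥0∞) (Γ.len e), Γ.pt e s = x → 0 < ndist t s := by
    intro s hs
    by_contra! h7
    simp only [ndist, nonpos_iff_eq_zero, add_eq_zero, tsub_eq_zero_iff_le] at h7
    exact hxy (hs ▸ congrArg _ (Subtype.ext (le_antisymm h7.1 h7.2)))
  have h7 : 0 < min (ENNReal.ofReal ε)
      ((finite_coordinates x e).toFinset.inf fun s => ndist t s) := by
    refine lt_min (ENNReal.ofReal_pos.2 hε) ((Finset.lt_inf_iff ENNReal.zero_lt_top).2 ?_)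
    intro s hs
    exact h6 s (by simpa using hs)
  rw [← min_pdist_eq hx h1, h3] at h7
  simp at h7

/-- Rational functions separate points. -/
lemma exists_ratFun_ne {x y : Γ.Pt} (hxy : y ≠ x) : ∃ f : Γ.RatFun, f y ≠ f x := by
  by_cases hx : IsInfinite x
  · obtain ⟨e, h, rfl⟩ := hx
    have hs : (Γ.origin e : ℝ≥0∞) < ⊤ := by simp [origin]
    refine ⟨⟨_, isRational_chipFiring_compl_tail h hs⟩, ?_⟩
    change chipFiring _ _ y ≠ chipFiring _ _ _
    have h1 : chipFiring (Γ.tail e (Γ.origin e))ᶜ ⊤ (Γ.pt e (Γ.terminus e)) = ⊥ := by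
      rw [chipFiring_compl_tail h hs]
      simp [terminus, origin, h]
    rw [h1]
    by_cases hy : y ∈ Γ.tail e (Γ.origin e)
    · obtain ⟨t, -, rfl⟩ := hy
      rw [chipFiring_compl_tail h hs]
      simp only [origin, tsub_zero, ne_eq, EReal.neg_eq_bot_iff, EReal.coe_ennreal_eq_top_iff]
      intro h2
      exact hxy (congrArg _ (Subtype.ext (by simp [h2, terminus, h])))
    · rw [chipFiring_compl_of_notMem hy]
      exact EReal.zero_ne_bot
  · obtain ⟨ε, hε, h1⟩ := exists_isGap x
    refine ⟨⟨_, isRational_chipFiring_singleton hx h1 ENNReal.ofReal_ne_top⟩, ?_⟩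
    change chipFiring _ _ y ≠ chipFiring _ _ _
    rw [chipFiring_singleton, chipFiring_singleton, Ne, neg_inj, EReal.coe_ennreal_eq_coe_ennreal_iff]
    simpa using ⟨hε, (pdist_pos hxy).ne'⟩

end EdgeWeightedGraph

/-! ### The induced bijection and its local Lipschitz bound. -/

namespace EdgeWeightedGraph

variable {Γ : EdgeWeightedGraph.{u}} {Γ₁ : EdgeWeightedGraph.{u}} {Γ₂ : EdgeWeightedGraph.{v}}

open RatFun

lemma clamp_injOn {e : Γ.E} {a b : ℝ} (ha : 0 ≤ a) (hb : ENNReal.ofReal b ≤ Γ.len e) :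
    InjOn (Γ.clamp e) (Icc a b) := by
  have h1 : ∀ t ∈ Icc a b, (Γ.clamp e t : ℝ≥0∞).toReal = t := fun t ht => by
    rw [show (Γ.clamp e t : ℝ≥0∞) = ENNReal.ofReal t from
      min_eq_left ((ENNReal.ofReal_le_ofReal ht.2).trans hb), ENNReal.toReal_ofReal (ha.trans ht.1)]
  intro s hs t ht hst
  rw [← h1 s hs, hst, h1 t ht]

/-- A point has only finitely many coordinates. This rules out a function that vanishes at one point
only and yet vanishes along a segment. -/
lemma not_forall_rpt_eq {e : Γ.E} {a b : ℝ} (ha : 0 ≤ a) (hb : ENNReal.ofReal b ≤ Γ.len e)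
    (hab : a < b) (x : Γ.Pt) : ¬ ∀ t ∈ Icc a b, Γ.rpt e t = x := by
  intro h
  refine (Icc_infinite hab).image (clamp_injOn ha hb) ((finite_coordinates x e).subset ?_)
  rintro _ ⟨t, ht, rfl⟩
  exact h t ht

variable (Γ) in
/-- The projection from the disjoint union of the vertices and edges. -/
def proj (p : Γ.PrePt) : Γ.Pt := Quot.mk _ p

lemma continuous_proj : Continuous Γ.proj := continuous_quot_mk

lemma proj_surjective : Function.Surjective Γ.proj := Quot.mk_surjective

/-- A nonpositive rational function that vanishes only at the finite point `x` lies below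
`CF({x}; δ)` for some `δ`. -/
lemma exists_le_chipFiring {f : Γ.RatFun} (hf : f ≠ 0) (hf0 : ∀ y, f y ≤ 0) {x : Γ.Pt}
    (hx : ¬ IsInfinite x) (hfx : ∀ y, f y = 0 → y = x) :
    ∃ δ : ℝ≥0∞, 0 < δ ∧ ∀ y, f y ≤ chipFiring {x} δ y := by
  have hmono : ∀ {δ δ' : ℝ≥0∞} (y : Γ.Pt), δ ≤ δ' → chipFiring {x} δ' y ≤ chipFiring {x} δ y := by
    intro δ δ' y h
    rw [chipFiring_singleton, chipFiring_singleton, EReal.neg_le_neg_iff]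
    exact EReal.coe_ennreal_le_coe_ennreal_iff.2 (min_le_min_right _ h)
  have hdist : ∀ y, f y ≤ -(pdist y x : EReal) → f y ≤ chipFiring {x} 1 y := fun y h => by
    rw [chipFiring_singleton]
    exact h.trans (EReal.neg_le_neg_iff.2 (EReal.coe_ennreal_le_coe_ennreal_iff.2
      (min_le_right _ _)))
  have key : ∃ δ : ℝ≥0∞, 0 < δ ∧ ∀ p ∈ (univ : Set Γ.PrePt),
      f (Γ.proj p) ≤ chipFiring {x} δ (Γ.proj p) := by
    refine isCompact_univ.induction_on (p := fun S : Set Γ.PrePt => ∃ δ : ℝ≥0∞, 0 < δ ∧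
      ∀ p ∈ S, f (Γ.proj p) ≤ chipFiring {x} δ (Γ.proj p)) ⟨1, one_pos, by simp⟩ ?_ ?_ ?_
    · rintro S T hST ⟨δ, hδ, h⟩
      exact ⟨δ, hδ, fun p hp => h p (hST hp)⟩
    · rintro S T ⟨δ, hδ, h⟩ ⟨δ', hδ', h'⟩
      refine ⟨min δ δ', lt_min hδ hδ', ?_⟩
      rintro p (hp | hp)
      · exact (h p hp).trans (hmono _ (min_le_left _ _))
      · exact (h' p hp).trans (hmono _ (min_le_right _ _))
    intro p _
    rw [nhdsWithin_univ]
    -- Where `f` is negative it stays below some real `c < 0` nearby, and `δ = -c` works.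
    rcases (hf0 (Γ.proj p)).lt_or_eq with hp | hp
    · obtain ⟨c, hc1, hc2⟩ := EReal.lt_iff_exists_real_btwn.1 hp
      have hc : c < 0 := by exact_mod_cast hc2
      refine ⟨{q | f (Γ.proj q) < c}, (isOpen_lt (f.continuous.comp continuous_proj)
        continuous_const).mem_nhds hc1, ENNReal.ofReal (-c), ENNReal.ofReal_pos.2 (by linarith),
        fun q hq => ?_⟩
      have h1 : (c : EReal) = -((ENNReal.ofReal (-c) : ℝ≥0∞) : EReal) := by
        rw [coe_neg_ennreal ENNReal.ofReal_ne_top, ENNReal.toReal_ofReal (by linarith), neg_neg]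
      refine (le_of_lt hq).trans ?_
      rw [chipFiring_singleton, h1]
      exact EReal.neg_le_neg_iff.2 (EReal.coe_ennreal_le_coe_ennreal_iff.2 (min_le_left _ _))
    have hpx := hfx _ hp
    -- Vertices are isolated in the disjoint union, so the slope estimate is needed only on edges.
    rcases p with v | ⟨e, t₀⟩
    · refine ⟨Sum.inl '' {v}, (IsOpenEmbedding.inl.isOpenMap _ (isOpen_discrete _)).mem_nhds
        ⟨v, rfl, rfl⟩, 1, one_pos, ?_⟩
      rintro _ ⟨_, rfl, rfl⟩
      rw [chipFiring_singleton, hpx]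
      simpa using hf0 x
    · have ht₀ : (t₀ : ℝ≥0∞) < ⊤ := by
        refine coe_lt_top_of_not_isInfinite (e := e) ?_
        rw [show Γ.pt e t₀ = x from hpx]
        exact hx
      obtain ⟨τ, hτ⟩ : ∃ τ, τ = (t₀ : ℝ≥0∞).toReal := ⟨_, rfl⟩
      have hτx : Γ.rpt e τ = x := by
        rw [rpt, hτ, clamp_toReal t₀ ht₀]
        exact hpx
      have hτ0 : edgeVal f e τ = 0 := by
        rw [edgeVal, hτx, ← hpx, hp, EReal.toReal_zero]
      have hneg : ∀ t, edgeVal f e t ≤ 0 := fun t => by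
        have := hf0 (Γ.rpt e t)
        rw [← coe_edgeVal hf] at this
        exact_mod_cast this
      have hzero : ∀ t, edgeVal f e t = 0 → Γ.rpt e t = x := fun t ht => hfx _ (by
        rw [← coe_edgeVal hf, ht, EReal.coe_zero])
      obtain ⟨m, n, δ, hδ, hm, hn⟩ := exists_slopes hf e τ
      rw [hτ0] at hm hn
      refine ⟨(fun t => Sum.inr ⟨e, t⟩) '' {t : Icc (0 : ℝ≥0∞) (Γ.len e) |
        f (Γ.pt e t) ≤ chipFiring {x} 1 (Γ.pt e t)}, ?_, 1, one_pos, ?_⟩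
      swap
      · rintro _ ⟨t, ht, rfl⟩
        exact ht
      have hopen : IsOpenEmbedding (fun t : Icc (0 : ℝ≥0∞) (Γ.len e) =>
          (Sum.inr ⟨e, t⟩ : Γ.PrePt)) := IsOpenEmbedding.inr.comp IsOpenEmbedding.sigmaMk
      rw [← hopen.map_nhds_eq t₀]
      refine image_mem_map ?_
      have hcont : Tendsto (fun t : Icc (0 : ℝ≥0∞) (Γ.len e) => (t : ℝ≥0∞).toReal) (𝓝 t₀)
          (𝓝 τ) := by
        rw [hτ]
        exact (ENNReal.tendsto_toReal ht₀.ne).comp (continuous_subtype_val.tendsto t₀)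
      filter_upwards [hcont (Ioo_mem_nhds (sub_lt_self τ hδ) (lt_add_of_pos_right τ hδ)),
        continuous_subtype_val.tendsto t₀ (Iio_mem_nhds ht₀)] with t ht ht'
      obtain ⟨h1, h2⟩ : τ - δ < (t : ℝ≥0∞).toReal ∧ (t : ℝ≥0∞).toReal < τ + δ := ht
      have htop : (t : ℝ≥0∞) < ⊤ := ht'
      have hlen : ENNReal.ofReal (t : ℝ≥0∞).toReal ≤ Γ.len e := by
        rw [ENNReal.ofReal_toReal htop.ne]
        exact t.2.2
      have hlen₀ : ENNReal.ofReal τ ≤ Γ.len e := by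
        rw [hτ, ENNReal.ofReal_toReal ht₀.ne]
        exact t₀.2.2
      have hpos : 0 ≤ (t : ℝ≥0∞).toReal := ENNReal.toReal_nonneg
      have hpos₀ : 0 ≤ τ := hτ ▸ ENNReal.toReal_nonneg
      have hpt : Γ.pt e t = Γ.rpt e (t : ℝ≥0∞).toReal := by rw [rpt, clamp_toReal t htop]
      refine hdist _ ?_
      rw [hpt]
      generalize (t : ℝ≥0∞).toReal = s at *
      -- A nonnegative slope away from `x`, together with `f ≤ 0`, would make `f` vanish on a
      -- segment. So the slope is a negative integer, hence at most `-1`.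
      have hle : edgeVal f e s ≤ -|s - τ| := by
        rcases lt_trichotomy τ s with h3 | h3 | h3
        · have h4 : m ≤ -1 := by
            by_contra! h5
            have h6 : (0 : ℝ) ≤ m := by exact_mod_cast (by omega : 0 ≤ m)
            refine not_forall_rpt_eq hpos₀ hlen h3 x fun u hu => hzero u ?_
            refine le_antisymm (hneg u) ?_
            rw [hm u ⟨hu.1, by linarith [hu.2]⟩]
            nlinarith [hu.1]
          have h5 : (m : ℝ) ≤ -1 := by exact_mod_cast h4
          rw [hm s ⟨h3.le, h2.le⟩, abs_of_pos (by linarith)]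
          nlinarith
        · rw [← h3]
          simpa using hneg τ
        · have h4 : n ≤ -1 := by
            by_contra! h5
            have h6 : (0 : ℝ) ≤ n := by exact_mod_cast (by omega : 0 ≤ n)
            refine not_forall_rpt_eq hpos hlen₀ h3 x fun u hu => hzero u ?_
            refine le_antisymm (hneg u) ?_
            rw [hn u ⟨by linarith [hu.1], hu.2⟩]
            nlinarith [hu.2]
          have h5 : (n : ℝ) ≤ -1 := by exact_mod_cast h4
          rw [hn s ⟨h1.le, h3.le⟩, abs_of_neg (by linarith)]
          nlinarith
      rw [← coe_edgeVal hf]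
      refine (EReal.coe_le_coe_iff.2 hle).trans ?_
      have h3 : pdist (Γ.rpt e s) x ≤ ENNReal.ofReal |s - τ| := by
        rw [← hτx, abs_sub_comm]
        exact pdist_rpt_le e s τ
      rw [coe_neg_ennreal (ne_top_of_le_ne_top ENNReal.ofReal_ne_top h3), EReal.coe_le_coe_iff,
        neg_le_neg_iff]
      exact ENNReal.toReal_le_of_le_ofReal (abs_nonneg _) h3
  obtain ⟨δ, hδ, h⟩ := key
  exact ⟨δ, hδ, fun y => by
    obtain ⟨p, rfl⟩ := proj_surjective y
    exact h p (mem_univ p)⟩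

/-- The map `φ` is compatible with the semiring isomorphism `ψ` and the scale `r`. -/
def Compat (ψ : Γ₁.RatFun ≃+* Γ₂.RatFun) (r : ℝ) (φ : Γ₁.Pt ≃ Γ₂.Pt) : Prop :=
  ∀ f x, ψ f (φ x) = r * f x

lemma inv_mul_coe_mul {r : ℝ} (hr : 0 < r) (a : EReal) :
    ((r⁻¹ : ℝ) : EReal) * ((r : EReal) * a) = a := by
  rw [← mul_assoc, ← EReal.coe_mul, inv_mul_cancel₀ hr.ne', EReal.coe_one, one_mul]

/-- The point maps obtained from `ψ` and from `ψ.symm` are mutually inverse because rational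
functions separate points. -/
lemma exists_compat {ψ : Γ₁.RatFun ≃+* Γ₂.RatFun} {r : ℝ} (hr : 0 < r)
    (hψ : ∀ c, ψ (const Γ₁ c) = const Γ₂ (r * c)) : ∃ φ : Γ₁.Pt ≃ Γ₂.Pt, Compat ψ r φ := by
  choose ξ hξ using exists_eval_eq hr hψ
  choose φ hφ using exists_eval_eq (inv_pos.2 hr) (scale_symm hr hψ)
  have h1 : ∀ f x, ψ f (φ x) = r * f x := fun f x => by
    have h2 := hφ x (ψ f)
    rw [RingEquiv.symm_apply_apply] at h2
    rw [h2, ← mul_assoc, ← EReal.coe_mul, mul_inv_cancel₀ hr.ne', EReal.coe_one, one_mul]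
  refine ⟨⟨φ, ξ, fun x => ?_, fun y => ?_⟩, h1⟩
  · by_contra h
    obtain ⟨f, hf⟩ := exists_ratFun_ne h
    have h2 := (hξ (φ x) f).symm.trans (h1 f x)
    exact hf (by rw [← inv_mul_coe_mul hr (f _), h2, inv_mul_coe_mul hr])
  · by_contra h
    obtain ⟨g, hg⟩ := exists_ratFun_ne h
    obtain ⟨f, rfl⟩ := ψ.surjective g
    exact hg ((h1 f (ξ y)).trans (hξ y f).symm)

namespace Compat

variable {ψ : Γ₁.RatFun ≃+* Γ₂.RatFun} {r : ℝ} {φ : Γ₁.Pt ≃ Γ₂.Pt}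

lemma symm (h : Compat ψ r φ) (hr : 0 < r) : Compat ψ.symm r⁻¹ φ.symm := by
  intro g y
  obtain ⟨f, rfl⟩ := ψ.surjective g
  obtain ⟨x, rfl⟩ := φ.surjective y
  rw [h f x, RingEquiv.symm_apply_apply, Equiv.symm_apply_apply, inv_mul_coe_mul hr]

/-- Evaluation embeds the compact space `Γ₂.Pt` into a product of copies of the Hausdorff space
`EReal`. The coordinates of `φ` in this product are the continuous functions `r * ψ.symm g`. -/
lemma continuous (h : Compat ψ r φ) (hr : 0 < r) : Continuous φ := by
  let j : Γ₂.Pt → (Γ₂.RatFun → EReal) := fun y g => g y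
  have hj : Continuous j := continuous_pi fun g => g.continuous
  have hinj : Function.Injective j := fun y z hyz => by
    by_contra hne
    obtain ⟨g, hg⟩ := exists_ratFun_ne hne
    exact hg (congrFun hyz g)
  rw [(hj.isClosedEmbedding hinj).isEmbedding.continuous_iff]
  refine continuous_pi fun g => ?_
  have h1 : (fun x => j (φ x) g) = fun x => (r : EReal) * ψ.symm g x := funext fun x => by
    rw [← h, RingEquiv.apply_symm_apply]
  change Continuous fun x => j (φ x) g
  rw [h1]
  have hr' : (r : EReal) ≠ 0 := by exact_mod_cast hr.ne'
  exact continuous_iff_continuousAt.2 fun x => EReal.Tendsto.mul tendsto_const_nhds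
    ((ψ.symm g).continuous.tendsto x) (Or.inl hr') (Or.inl hr') (Or.inl (EReal.coe_ne_bot r))
    (Or.inl (EReal.coe_ne_top r))

/-- A nonzero rational function takes the value `-∞` only at points at infinity, and at each of
these some nonzero function takes it; `φ` preserves this value. -/
lemma isInfinite (h : Compat ψ r φ) (hr : 0 < r) {x : Γ₁.Pt} (hx : IsInfinite x) :
    IsInfinite (φ x) := by
  by_contra hc
  obtain ⟨e, he, rfl⟩ := hx
  have hs : (Γ₁.origin e : ℝ≥0∞) < ⊤ := by simp [origin]
  let T : Γ₁.RatFun := ⟨_, isRational_chipFiring_compl_tail he hs⟩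
  have h1 : T (Γ₁.pt e (Γ₁.terminus e)) = ⊥ := by
    change chipFiring _ _ _ = _
    rw [chipFiring_compl_tail he hs]
    simp [terminus, origin, he]
  have h2 : T (Γ₁.pt e (Γ₁.origin e)) = 0 := by
    change chipFiring _ _ _ = _
    rw [chipFiring_compl_tail he hs]
    simp
  have h3 : T ≠ 0 := by
    intro h3
    rw [h3] at h2
    exact EReal.bot_ne_zero h2
  have h4 : ψ T ≠ 0 := by rwa [Ne, map_eq_zero_iff ψ ψ.injective]
  have h5 := h T (Γ₁.pt e (Γ₁.terminus e))
  rw [h1, EReal.coe_mul_bot_of_pos hr] at h5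
  exact ((regular_of_ne_zero h4).1 _ hc).1 h5

lemma isInfinite_iff (h : Compat ψ r φ) (hr : 0 < r) (x : Γ₁.Pt) :
    IsInfinite (φ x) ↔ IsInfinite x := by
  refine ⟨fun hx => ?_, h.isInfinite hr⟩
  have := (h.symm hr).isInfinite (inv_pos.2 hr) hx
  rwa [Equiv.symm_apply_apply] at this

lemma coe_mul_neg_ennreal {r : ℝ} (hr : 0 < r) (a : ℝ≥0∞) :
    (r : EReal) * -(a : EReal) = -((ENNReal.ofReal r * a : ℝ≥0∞) : EReal) := by
  rw [mul_neg, EReal.coe_ennreal_mul, EReal.coe_ennreal_ofReal, max_eq_left hr.le]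

/-- `exists_le_chipFiring` applies to the image of a chip-firing move at `x`, whose value at `φ z`
is known from compatibility; comparing the two gives the bound. -/
lemma exists_pdist_le (h : Compat ψ r φ) (hr : 0 < r) {x : Γ₁.Pt} (hx : ¬ IsInfinite x) :
    ∃ δ : ℝ≥0∞, 0 < δ ∧ ∀ z, pdist z x < δ →
      pdist (φ z) (φ x) ≤ ENNReal.ofReal r * pdist z x := by
  obtain ⟨ε, hε, hgap⟩ := exists_isGap x
  let F : Γ₁.RatFun := ⟨_, isRational_chipFiring_singleton hx hgap ENNReal.ofReal_ne_top⟩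
  have hF : ∀ z, F z = -((min (ENNReal.ofReal ε) (pdist z x) : ℝ≥0∞) : EReal) :=
    fun z => chipFiring_singleton x z _
  have hψF : ∀ z, ψ F (φ z) =
      -((ENNReal.ofReal r * min (ENNReal.ofReal ε) (pdist z x) : ℝ≥0∞) : EReal) := fun z => by
    rw [h F z, hF, coe_mul_neg_ennreal hr]
  have hr' : ENNReal.ofReal r ≠ 0 := (ENNReal.ofReal_pos.2 hr).ne'
  have hne : ψ F ≠ 0 := by
    intro h0
    have h1 := hψF x
    rw [h0, zero_apply] at h1
    simp at h1
  obtain ⟨δ, hδ, hle⟩ := exists_le_chipFiring hne (fun y => by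
    obtain ⟨z, rfl⟩ := φ.surjective y
    rw [hψF]
    exact EReal.neg_le.1 (by rw [neg_zero]; exact EReal.coe_ennreal_nonneg _)) (mt (h.isInfinite_iff hr x).1 hx) (fun y hy => by
    obtain ⟨z, rfl⟩ := φ.surjective y
    rw [hψF, EReal.neg_eq_zero_iff, EReal.coe_ennreal_eq_zero, mul_eq_zero] at hy
    have h1 := hy.resolve_left hr'
    by_contra hzx
    have h2 : 0 < min (ENNReal.ofReal ε) (pdist z x) :=
      lt_min (ENNReal.ofReal_pos.2 hε) (pdist_pos fun h3 => hzx (by rw [h3]))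
    exact h2.ne' h1)
  -- Below this radius `r * pdist z x < δ`, so the minimum with `δ` is attained by the distance.
  refine ⟨δ / ENNReal.ofReal r, ENNReal.div_pos hδ.ne' ENNReal.ofReal_ne_top, fun z hz => ?_⟩
  have h1 := hle (φ z)
  rw [hψF, chipFiring_singleton, EReal.neg_le_neg_iff, EReal.coe_ennreal_le_coe_ennreal_iff] at h1
  have h2 : ENNReal.ofReal r * pdist z x < δ := by
    rw [mul_comm]
    exact (ENNReal.lt_div_iff_mul_lt (Or.inl hr') (Or.inl ENNReal.ofReal_ne_top)).1 hz
  have h3 : min δ (pdist (φ z) (φ x)) ≤ ENNReal.ofReal r * pdist z x :=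
    h1.trans (mul_le_mul_right (min_le_right _ _) _)
  exact (min_le_iff.1 h3).resolve_left h2.not_ge

/-- Continuous induction along the segment: the radius of the local bound depends on the point, but
the constant `r` does not, so the local bounds add up. -/
lemma pdist_rpt_le (h : Compat ψ r φ) (hr : 0 < r) (e : Γ₁.E) {a b : ℝ} (hab : a ≤ b) :
    pdist (φ (Γ₁.rpt e a)) (φ (Γ₁.rpt e b)) ≤ ENNReal.ofReal (r * (b - a)) := by
  let S : Set ℝ := {t | pdist (φ (Γ₁.rpt e a)) (φ (Γ₁.rpt e t)) ≤ ENNReal.ofReal (r * (t - a))}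
  have hloc : ∀ t, ∃ η : ℝ, 0 < η ∧ ∀ s, |s - t| < η →
      pdist (φ (Γ₁.rpt e s)) (φ (Γ₁.rpt e t)) ≤ ENNReal.ofReal (r * |s - t|) := by
    intro t
    obtain ⟨δ, hδ, h1⟩ := h.exists_pdist_le hr (not_isInfinite_rpt e t)
    obtain ⟨η, hη, h2⟩ : ∃ η : ℝ, 0 < η ∧ ENNReal.ofReal η ≤ δ := by
      obtain ⟨η, h3, h4⟩ := ENNReal.lt_iff_exists_real_btwn.1 hδ
      exact ⟨η, ENNReal.ofReal_pos.1 h4.1, h4.2.le⟩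
    refine ⟨η, hη, fun s hs => ?_⟩
    have h3 : pdist (Γ₁.rpt e s) (Γ₁.rpt e t) ≤ ENNReal.ofReal |s - t| := by
      rw [abs_sub_comm]
      exact EdgeWeightedGraph.pdist_rpt_le e s t
    refine (h1 _ (h3.trans_lt (lt_of_lt_of_le ?_ h2))).trans ?_
    · exact (ENNReal.ofReal_lt_ofReal_iff hη).2 hs
    · rw [ENNReal.ofReal_mul hr.le]
      gcongr
  have hS : Icc a b ⊆ S := by
    refine IsClosed.Icc_subset_of_forall_exists_gt ?_ ?_ ?_
    · refine IsSeqClosed.isClosed fun w t hw ht => ⟨?_, isClosed_Icc.mem_of_tendsto ht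
        (Eventually.of_forall fun n => (hw n).2)⟩
      obtain ⟨η, hη, h1⟩ := hloc t
      have h2 : Tendsto (fun n => ENNReal.ofReal (r * (w n - a) + r * |w n - t|)) atTop
          (𝓝 (ENNReal.ofReal (r * (t - a) + r * |t - t|))) :=
        ENNReal.tendsto_ofReal (((ht.sub_const a).const_mul r).add
          ((ht.sub_const t).abs.const_mul r))
      rw [sub_self, abs_zero, mul_zero, add_zero] at h2
      refine ge_of_tendsto h2 ?_
      filter_upwards [Metric.tendsto_nhds.1 ht η hη] with n hn
      rw [ENNReal.ofReal_add (mul_nonneg hr.le (sub_nonneg.2 (hw n).2.1)) (by positivity)]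
      exact (pdist_triangle _ _ _).trans (add_le_add (hw n).1 (h1 _ hn))
    · simp [S]
    · rintro x ⟨hx, hx'⟩ y hy
      obtain ⟨η, hη, h1⟩ := hloc x
      have hpos : 0 < min (η / 2) (y - x) := lt_min (by linarith) (sub_pos.2 hy)
      refine ⟨x + min (η / 2) (y - x), ?_, by linarith, by linarith [min_le_right (η / 2) (y - x)]⟩
      have h2 := h1 (x + min (η / 2) (y - x)) (by
        rw [add_sub_cancel_left, abs_of_pos hpos]
        linarith [min_le_left (η / 2) (y - x)])
      rw [add_sub_cancel_left, abs_of_pos hpos, pdist_comm] at h2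
      refine (pdist_triangle _ _ _).trans ((add_le_add hx h2).trans (le_of_eq ?_))
      rw [← ENNReal.ofReal_add (mul_nonneg hr.le (by linarith [hx'.1])) (by positivity)]
      congr 1
      ring
  exact hS ⟨hab, le_rfl⟩

end Compat

end EdgeWeightedGraph

/-! ### Global dilation, tails at infinity and uniqueness. -/

namespace EdgeWeightedGraph

variable {Γ : EdgeWeightedGraph.{u}} {Γ₁ : EdgeWeightedGraph.{u}} {Γ₂ : EdgeWeightedGraph.{v}}

open RatFun

/-- The function `CF(Γ \ (y, x]; ∞)`, where `y` is the start of the edge with end `x`. -/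
noncomputable def tailFun {e : Γ.E} (h : Γ.len e = ⊤) : Γ.RatFun :=
  ⟨_, isRational_chipFiring_compl_tail h (s := Γ.origin e) ENNReal.zero_lt_top⟩

lemma tailFun_pt {e : Γ.E} (h : Γ.len e = ⊤) (t : Icc (0 : ℝ≥0∞) (Γ.len e)) :
    tailFun h (Γ.pt e t) = -((t : ℝ≥0∞) : EReal) := by
  change chipFiring _ _ _ = _
  rw [chipFiring_compl_tail h ENNReal.zero_lt_top]
  simp [origin]

lemma mem_tail_iff {e : Γ.E} (h : Γ.len e = ⊤) (s : Icc (0 : ℝ≥0∞) (Γ.len e)) (x : Γ.Pt) :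
    x ∈ Γ.tail e s ↔ tailFun h x < -((s : ℝ≥0∞) : EReal) := by
  constructor
  · rintro ⟨t, ht, rfl⟩
    rw [tailFun_pt, EReal.neg_lt_neg_iff, EReal.coe_ennreal_lt_coe_ennreal_iff]
    exact ht
  · intro hx
    by_cases h1 : x ∈ Γ.tail e (Γ.origin e)
    · obtain ⟨t, -, rfl⟩ := h1
      rw [tailFun_pt, EReal.neg_lt_neg_iff, EReal.coe_ennreal_lt_coe_ennreal_iff] at hx
      exact ⟨t, hx, rfl⟩
    · have h2 : tailFun h x = 0 := chipFiring_compl_of_notMem h1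
      rw [h2] at hx
      have h3 : -((s : ℝ≥0∞) : EReal) ≤ 0 :=
        EReal.neg_le.1 (by rw [neg_zero]; exact EReal.coe_ennreal_nonneg _)
      exact absurd hx h3.not_gt

lemma exists_ratFun {f : Γ.Pt → EReal} (hf : IsRational f) : ∃ F : Γ.RatFun, ⇑F = f :=
  ⟨⟨f, hf⟩, rfl⟩

/-- A rational function is affine near the end of an edge of infinite length. -/
lemma exists_affine_near_end {g : Γ.RatFun} (hg : g ≠ 0) (e : Γ.E) :
    ∃ (a : ℝ≥0∞) (m : ℤ) (c : ℝ), a < ⊤ ∧ ∀ t : Icc (0 : ℝ≥0∞) (Γ.len e), a < t →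
      (t : ℝ≥0∞) < ⊤ → g (Γ.pt e t) = ((m * (t : ℝ≥0∞).toReal + c : ℝ) : EReal) := by
  obtain ⟨S, hS⟩ := (regular_of_ne_zero hg).2 e
  have ha : (S.filter (· < ⊤)).sup id < ⊤ := by
    rw [Finset.sup_lt_iff (by simp)]
    simp
  obtain ⟨m, c, hmc⟩ := hS ((S.filter (· < ⊤)).sup id) ⊤ (by
    rintro s hs ⟨h1, h2⟩
    have h3 : s ≤ (S.filter (· < ⊤)).sup id :=
      Finset.le_sup (f := id) (Finset.mem_filter.2 ⟨hs, h2⟩)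
    exact absurd h1 h3.not_gt)
  exact ⟨_, m, c, ha, hmc⟩

namespace Compat

variable {ψ : Γ₁.RatFun ≃+* Γ₂.RatFun} {r : ℝ} {φ : Γ₁.Pt ≃ Γ₂.Pt}

lemma pdist_le_of_chainLength (h : Compat ψ r φ) (hr : 0 < r) {x y : Γ₁.Pt} {L : ℝ≥0∞}
    (hL : ChainLength x y L) : pdist (φ x) (φ y) ≤ ENNReal.ofReal r * L := by
  induction hL with
  | refl => simp
  | step e s t y L _ ih =>
    have hr' : ENNReal.ofReal r ≠ 0 := (ENNReal.ofReal_pos.2 hr).ne'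
    have key : ∀ s t : Icc (0 : ℝ≥0∞) (Γ₁.len e), s ≤ t →
        pdist (φ (Γ₁.pt e s)) (φ (Γ₁.pt e t)) ≤ ENNReal.ofReal r * ((t : ℝ≥0∞) - s) := by
      intro s t hst
      have hst' : (s : ℝ≥0∞) ≤ t := hst
      rcases hst.eq_or_lt with rfl | hlt
      · simp
      have hs : (s : ℝ≥0∞) < ⊤ := lt_of_lt_of_le (show (s : ℝ≥0∞) < t from hlt) le_top
      by_cases ht : (t : ℝ≥0∞) = ⊤
      · rw [ht, ENNReal.top_sub hs.ne, ENNReal.mul_top hr']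
        exact le_top
      · rw [← clamp_toReal s hs, ← clamp_toReal t (lt_top_iff_ne_top.2 ht)]
        refine (h.pdist_rpt_le hr e (ENNReal.toReal_mono ht hst')).trans ?_
        rw [clamp_toReal s hs, clamp_toReal t (lt_top_iff_ne_top.2 ht),
          ENNReal.ofReal_mul hr.le, ← ENNReal.toReal_sub_of_le hst' ht]
        exact mul_le_mul_right ENNReal.ofReal_toReal_le _
    refine (pdist_triangle _ (φ (Γ₁.pt e t)) _).trans ?_
    rw [mul_add]
    refine add_le_add ?_ ih
    rcases le_total s t with hst | hst
    · rw [tsub_eq_zero_of_le (show (s : ℝ≥0∞) ≤ t from hst), zero_add]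
      exact key s t hst
    · rw [tsub_eq_zero_of_le (show (t : ℝ≥0∞) ≤ s from hst), add_zero, pdist_comm]
      exact key t s hst

lemma pdist_le (h : Compat ψ r φ) (hr : 0 < r) (x y : Γ₁.Pt) :
    pdist (φ x) (φ y) ≤ ENNReal.ofReal r * pdist x y := by
  have hr' : ENNReal.ofReal r ≠ 0 := (ENNReal.ofReal_pos.2 hr).ne'
  rw [mul_comm, ← ENNReal.div_le_iff_le_mul (Or.inl hr') (Or.inl ENNReal.ofReal_ne_top)]
  refine le_sInf fun L hL => ?_
  rw [ENNReal.div_le_iff_le_mul (Or.inl hr') (Or.inl ENNReal.ofReal_ne_top), mul_comm]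
  exact h.pdist_le_of_chainLength hr hL

/-- The missing inequality is `pdist_le` for the inverse pair, with scale `r⁻¹`. -/
lemma pdist_eq (h : Compat ψ r φ) (hr : 0 < r) (x y : Γ₁.Pt) :
    ENNReal.ofReal r * pdist x y = pdist (φ x) (φ y) := by
  refine le_antisymm ?_ (h.pdist_le hr x y)
  have h1 := (h.symm hr).pdist_le (inv_pos.2 hr) (φ x) (φ y)
  rw [Equiv.symm_apply_apply, Equiv.symm_apply_apply] at h1
  calc ENNReal.ofReal r * pdist x y
      ≤ ENNReal.ofReal r * (ENNReal.ofReal r⁻¹ * pdist (φ x) (φ y)) := mul_le_mul_right h1 _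
    _ = pdist (φ x) (φ y) := by
      rw [← mul_assoc, ← ENNReal.ofReal_mul hr.le, mul_inv_cancel₀ hr.ne', ENNReal.ofReal_one,
        one_mul]

lemma isExpansive (h : Compat ψ r φ) (hr : 0 < r) : IsExpansive r φ :=
  ⟨h.continuous hr, φ.bijective, h.isInfinite_iff hr, fun x y _ _ => h.pdist_eq hr x y⟩

lemma apply_eq (h : Compat ψ r φ) (f : Γ₁.RatFun) :
    ⇑(ψ f) = (fun x => (r : EReal) * f x) ∘ φ.symm := by
  funext y
  obtain ⟨x, rfl⟩ := φ.surjective y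
  rw [h f x, Function.comp_apply, Equiv.symm_apply_apply]

lemma chipFiring_image (h : Compat ψ r φ) (hr : 0 < r) (A : Set Γ₁.Pt) (l : ℝ≥0∞) (x : Γ₁.Pt) :
    chipFiring (φ '' A) (ENNReal.ofReal r * l) (φ x) = r * chipFiring A l x := by
  have hr' : ENNReal.ofReal r ≠ 0 := (ENNReal.ofReal_pos.2 hr).ne'
  have h1 : ⨅ a ∈ φ '' A, pdist (φ x) a = ENNReal.ofReal r * ⨅ a ∈ A, pdist x a := by
    simp only [iInf_image, ENNReal.mul_iInf_of_ne hr' ENNReal.ofReal_ne_top, h.pdist_eq hr]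
  have h2 : Monotone fun a => ENNReal.ofReal r * a := fun a b hab => mul_le_mul_right hab _
  rw [chipFiring, chipFiring, coe_mul_neg_ennreal hr, h1]
  congr 2
  exact (h2.map_min).symm

lemma map_eq_chipFiring (h : Compat ψ r φ) (hr : 0 < r) {A : Set Γ₁.Pt} {l : ℝ≥0∞}
    {f : Γ₁.RatFun} (hf : ⇑f = chipFiring A l) :
    ⇑(ψ f) = chipFiring (φ '' A) (ENNReal.ofReal r * l) := by
  funext y
  obtain ⟨x, rfl⟩ := φ.surjective y
  rw [h f x, hf, h.chipFiring_image hr]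

/-- Tails of `e'` are sublevel sets of `tailFun he'`. Its preimage `g` under `ψ` is affine with
negative slope near the end of `e` and bounded below elsewhere, so a low enough sublevel set of `g`
is a tail of `e`; `φ` matches the two sublevel sets. -/
lemma exists_image_tail_eq (h : Compat ψ r φ) (hr : 0 < r) {e : Γ₁.E} (he : Γ₁.len e = ⊤) :
    ∃ e' : Γ₂.E, Γ₂.len e' = ⊤ ∧ φ (Γ₁.pt e (Γ₁.terminus e)) = Γ₂.pt e' (Γ₂.terminus e') ∧
      ∃ (s : Icc (0 : ℝ≥0∞) (Γ₁.len e)) (s' : Icc (0 : ℝ≥0∞) (Γ₂.len e')),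
        (s : ℝ≥0∞) < ⊤ ∧ (s' : ℝ≥0∞) < ⊤ ∧ φ (Γ₁.pt e s) = Γ₂.pt e' s' ∧
        φ '' Γ₁.tail e s = Γ₂.tail e' s' := by
  obtain ⟨e', he', hφ⟩ := h.isInfinite hr ⟨e, he, rfl⟩
  refine ⟨e', he', hφ, ?_⟩
  obtain ⟨g, hg⟩ := ψ.surjective (tailFun he')
  have hgx : ∀ x, tailFun he' (φ x) = r * g x := fun x => by rw [← hg, h g x]
  have hr' : (0 : EReal) < r := by exact_mod_cast hr
  have hlt : ∀ (x : Γ₁.Pt) (v : ℝ), g x < v ↔ tailFun he' (φ x) < ((r * v : ℝ) : EReal) := by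
    intro x v
    rw [hgx, EReal.coe_mul]
    constructor
    · intro h1
      refine lt_of_le_of_ne (mul_le_mul_of_nonneg_left h1.le hr'.le) fun h2 => h1.ne ?_
      rw [← inv_mul_coe_mul hr (g x), h2, inv_mul_coe_mul hr]
    · intro h1
      by_contra! h2
      exact h1.not_ge (mul_le_mul_of_nonneg_left h2 hr'.le)
  have hg0 : g ≠ 0 := by
    rintro rfl
    rw [map_zero] at hg
    have h1 := tailFun_pt he' (Γ₂.origin e')
    rw [← hg, zero_apply] at h1
    simp [origin] at h1
  have hterm : ∀ x, g x = ⊥ → x = Γ₁.pt e (Γ₁.terminus e) := by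
    intro x hx
    have h1 := hgx x
    rw [hx, EReal.coe_mul_bot_of_pos hr] at h1
    have h2 : φ x ∈ Γ₂.tail e' (Γ₂.origin e') := by
      rw [mem_tail_iff he', h1]
      simp [origin]
    obtain ⟨t, -, h3⟩ := h2
    rw [← h3, tailFun_pt, EReal.neg_eq_bot_iff, EReal.coe_ennreal_eq_top_iff] at h1
    refine φ.injective ?_
    rw [hφ, ← h3]
    exact congrArg _ (Subtype.ext (by simp [h1, terminus, he']))
  have hbot : g (Γ₁.pt e (Γ₁.terminus e)) = ⊥ := by
    have h1 := hgx (Γ₁.pt e (Γ₁.terminus e))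
    have h2 : tailFun he' (Γ₂.pt e' (Γ₂.terminus e')) = ⊥ := by
      rw [tailFun_pt]
      simp [terminus, he']
    rw [hφ, h2] at h1
    rw [← inv_mul_coe_mul hr (g _), ← h1, EReal.coe_mul_bot_of_pos (inv_pos.2 hr)]
  obtain ⟨a, m, c, ha, haff⟩ := exists_affine_near_end hg0 e
  have haff' : ∀ s : ℝ, a.toReal < s → a < Γ₁.clamp e s ∧
      (Γ₁.clamp e s : ℝ≥0∞).toReal = s ∧ g (Γ₁.rpt e s) = ((m * s + c : ℝ) : EReal) := by
    intro s hs
    have h1 : (Γ₁.clamp e s : ℝ≥0∞) = ENNReal.ofReal s := by simp [clamp, he]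
    have h2 : a < Γ₁.clamp e s := by
      rw [h1]
      exact (ENNReal.lt_ofReal_iff_toReal_lt ha.ne).2 hs
    have h3 : (Γ₁.clamp e s : ℝ≥0∞).toReal = s := by
      rw [h1, ENNReal.toReal_ofReal (ENNReal.toReal_nonneg.trans hs.le)]
    refine ⟨h2, h3, ?_⟩
    rw [rpt, haff _ h2 (clamp_lt_top e s), h3]
  -- With slope `m ≥ 0`, `g` would stay at least `c` near the end, where its value is `-∞`.
  have hm : (m : ℝ) < 0 := by
    by_contra! hm
    have h1 := (g.continuous.tendsto _).comp (rpt_natCast_tendsto he)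
    rw [hbot] at h1
    have h2 : (c : EReal) ≤ ⊥ := by
      refine ge_of_tendsto h1 ?_
      filter_upwards [tendsto_natCast_atTop_atTop.eventually_gt_atTop a.toReal] with n hn
      rw [Function.comp_apply, (haff' n hn).2.2, EReal.coe_le_coe_iff]
      have : 0 ≤ (m : ℝ) * n := mul_nonneg hm n.cast_nonneg
      linarith
    exact (EReal.bot_lt_coe c).not_ge h2
  obtain ⟨C, hC⟩ : ∃ C : ℝ, ∀ x, x ∉ endNhd he ha → (C : EReal) < g x := by
    obtain ⟨x₀, hx₀, hmin⟩ := (isOpen_endNhd he ha).isClosed_compl.isCompact.exists_isMinOn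
      ⟨Γ₁.pt e (Γ₁.origin e), fun h1 => not_lt_zero h1.2⟩ g.continuous.continuousOn
    have h1 : ⊥ < g x₀ := by
      refine bot_lt_iff_ne_bot.2 fun h1 => hx₀ ?_
      rw [hterm x₀ h1]
      exact ⟨rfl, by simpa [terminus, he] using ha⟩
    obtain ⟨C, -, hC⟩ := EReal.lt_iff_exists_real_btwn.1 h1
    exact ⟨C, fun x hx => hC.trans_le (hmin hx)⟩
  -- A level below `C` keeps the sublevel set inside the neighbourhood where `g` is affine; a
  -- negative level puts the image of the cutting point on `e'`.
  obtain ⟨s, hsa, hsC⟩ : ∃ s : ℝ, a.toReal < s ∧ m * s + c < min C 0 := by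
    have h1 : Tendsto (fun s : ℝ => m * s + c) atTop atBot :=
      tendsto_atBot_add_const_right _ _ (tendsto_id.const_mul_atTop_of_neg hm)
    exact ((eventually_gt_atTop _).and (h1.eventually_lt_atBot _)).exists
  obtain ⟨hs1, hs2, hs3⟩ := haff' s hsa
  have hv0 : r * (m * s + c) < 0 := mul_neg_of_pos_of_neg hr (hsC.trans_le (min_le_right _ _))
  have hs4 : tailFun he' (φ (Γ₁.rpt e s)) = ((r * (m * s + c) : ℝ) : EReal) := by
    rw [hgx, hs3, ← EReal.coe_mul]
  obtain ⟨s', -, hs'⟩ : φ (Γ₁.rpt e s) ∈ Γ₂.tail e' (Γ₂.origin e') := by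
    rw [mem_tail_iff he', hs4]
    simp only [origin, EReal.coe_ennreal_zero, neg_zero]
    exact_mod_cast hv0
  rw [← hs', tailFun_pt] at hs4
  refine ⟨Γ₁.clamp e s, s', clamp_lt_top e s, ?_, hs'.symm, ?_⟩
  · refine lt_top_iff_ne_top.2 fun h1 => ?_
    rw [h1] at hs4
    exact EReal.coe_ne_bot _ (hs4.symm.trans (by simp))
  · have key : ∀ x, x ∈ Γ₁.tail e (Γ₁.clamp e s) ↔ φ x ∈ Γ₂.tail e' s' := by
      intro x
      rw [mem_tail_iff he', hs4, ← hlt]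
      constructor
      · rintro ⟨t, ht, rfl⟩
        have hst : (Γ₁.clamp e s : ℝ≥0∞) < t := ht
        by_cases htop : (t : ℝ≥0∞) = ⊤
        · have h1 : t = Γ₁.terminus e := Subtype.ext (by simp [htop, terminus, he])
          rw [h1, hbot]
          exact EReal.bot_lt_coe _
        · rw [haff t (hs1.trans hst) (lt_top_iff_ne_top.2 htop), EReal.coe_lt_coe_iff]
          have h1 := (ENNReal.toReal_lt_toReal (clamp_lt_top e s).ne htop).2 hst
          rw [hs2] at h1
          nlinarith
      · intro hx
        have h1 : x ∈ endNhd he ha := by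
          by_contra h1
          refine (hC x h1).not_gt (hx.trans ?_)
          exact_mod_cast hsC.trans_le (min_le_left _ _)
        obtain ⟨t, ht, rfl⟩ := exists_of_mem_endNhd he ha h1
        refine ⟨t, ?_, rfl⟩
        change (Γ₁.clamp e s : ℝ≥0∞) < t
        by_cases htop : (t : ℝ≥0∞) = ⊤
        · rw [htop]
          exact clamp_lt_top e s
        · rw [haff t ht (lt_top_iff_ne_top.2 htop), EReal.coe_lt_coe_iff] at hx
          refine (ENNReal.toReal_lt_toReal (clamp_lt_top e s).ne htop).1 ?_
          rw [hs2]
          nlinarith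
    ext y
    obtain ⟨x, rfl⟩ := φ.surjective y
    rw [φ.injective.mem_set_image, key]

lemma isInducedBy (h : Compat ψ r φ) (hr : 0 < r) : IsInducedBy ψ r φ := by
  refine ⟨fun x hx => ⟨mt (h.isInfinite_iff hr x).1 hx, ?_⟩, fun e he => ?_⟩
  · obtain ⟨ε, hε, hgap⟩ := exists_isGap x
    obtain ⟨f, hf⟩ := exists_ratFun (isRational_chipFiring_singleton hx hgap ENNReal.ofReal_ne_top)
    refine ⟨ε, hε, f, hf, ?_⟩
    rw [h.map_eq_chipFiring hr hf, image_singleton, ENNReal.ofReal_mul hr.le]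
  · obtain ⟨e', he', h1, s, s', hs, hs', h2, h3⟩ := h.exists_image_tail_eq hr he
    obtain ⟨f, hf⟩ := exists_ratFun (isRational_chipFiring_compl_tail he hs)
    refine ⟨e', he', h1, s, s', hs, hs', h2, f, hf, ?_⟩
    rw [h.map_eq_chipFiring hr hf, image_compl_eq φ.bijective, h3,
      ENNReal.mul_top (ENNReal.ofReal_pos.2 hr).ne']

/-- The moves that define `φ' x` determine it: `chipFiring {φ' x} _` vanishes only at `φ' x`, and
the move on a tail is `-∞` only at the end of the edge. Compatibility produces the same value at `φ
x`. -/
lemma eq_of_isInducedBy (h : Compat ψ r φ) (hr : 0 < r) {φ' : Γ₁.Pt → Γ₂.Pt}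
    (h' : IsInducedBy ψ r φ') : φ' = φ := by
  funext x
  by_cases hx : IsInfinite x
  · obtain ⟨e, he, rfl⟩ := hx
    obtain ⟨e', he', h1, s, s', hs, hs', -, f, hf, hψf⟩ := h'.infinite e he
    have h2 : ψ f (φ (Γ₁.pt e (Γ₁.terminus e))) = ⊥ := by
      rw [h f, hf, chipFiring_compl_tail he hs]
      simp [terminus, he, ENNReal.top_sub hs.ne, EReal.coe_mul_bot_of_pos hr]
    rw [hψf] at h2
    by_cases h3 : φ (Γ₁.pt e (Γ₁.terminus e)) ∈ Γ₂.tail e' s'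
    · obtain ⟨t, -, h4⟩ := h3
      rw [← h4, chipFiring_compl_tail he' hs', EReal.neg_eq_bot_iff,
        EReal.coe_ennreal_eq_top_iff] at h2
      have h5 : (t : ℝ≥0∞) = ⊤ := by
        by_contra h5
        exact (tsub_le_self.trans_lt (lt_top_iff_ne_top.2 h5)).ne h2
      rw [h1, ← h4]
      exact congrArg _ (Subtype.ext (by simp [h5, terminus, he']))
    · rw [chipFiring_compl_of_notMem h3] at h2
      exact absurd h2 EReal.zero_ne_bot
  · obtain ⟨-, ε, hε, f, hf, hψf⟩ := h'.finite x hx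
    have h1 := h f x
    rw [hψf, hf, chipFiring_singleton, chipFiring_singleton, pdist_self, min_eq_right zero_le,
      EReal.coe_ennreal_zero, neg_zero, mul_zero, EReal.neg_eq_zero_iff,
      EReal.coe_ennreal_eq_zero] at h1
    by_contra hne
    have h2 : 0 < min (ENNReal.ofReal (r * ε)) (pdist (φ x) (φ' x)) :=
      lt_min (ENNReal.ofReal_pos.2 (mul_pos hr hε)) (pdist_pos fun h3 => hne h3.symm)
    exact h2.ne' h1

end Compat

end EdgeWeightedGraph

/-- A semiring isomorphism `ψ : Rat(Γ₁) → Rat(Γ₂)` maps the real constant `1` to a positive real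
constant `r`, it induces a unique map `φ : Γ₁ → Γ₂`, this map is `r`-expansive, and
`ψ f = (r · f) ∘ φ⁻¹` for every rational function `f` on `Γ₁`. -/
theorem corollary5 (Γ₁ : EdgeWeightedGraph.{u}) (Γ₂ : EdgeWeightedGraph.{v})
    (ψ : Γ₁.RatFun ≃+* Γ₂.RatFun) :
    ∃ r : ℝ, 0 < r ∧ ψ (RatFun.const Γ₁ 1) = RatFun.const Γ₂ r ∧
      ∃ φ : Γ₁.Pt ≃ Γ₂.Pt, IsExpansive r φ ∧ IsInducedBy ψ r φ ∧
        (∀ φ' : Γ₁.Pt → Γ₂.Pt, IsInducedBy ψ r φ' → φ' = φ) ∧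
        ∀ f : Γ₁.RatFun, ⇑(ψ f) = (fun x => (r : EReal) * f x) ∘ φ.symm := by
  obtain ⟨r, hr, hψ⟩ := exists_scale ψ
  obtain ⟨φ, hφ⟩ := exists_compat hr hψ
  exact ⟨r, hr, by rw [hψ, mul_one], φ, hφ.isExpansive hr, hφ.isInducedBy hr,
    fun φ' h => hφ.eq_of_isInducedBy hr h, hφ.apply_eq⟩
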